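/- **Setting.** Let $m,n\ge 0$, let $U\subseteq\mathbb R^{m+n}$ be open, with the Euclidean norm, and let $E$ be a continuous tangent subbundle of rank $m$ on $U$, i.e. a family of subspaces $E_p\subseteq\mathbb R^{m+n}$ $(p\in U)$ that is locally spanned by $m$ continuous pointwise linearly independent vector fields ($C^1$ subbundles are defined in the same way with $C^1$ vector fields). An *integral manifold* of $E$ is an embedded $m$-dimensional $C^1$ submanifold $N\subseteq U$ with $T_pN=E_p$ for all $p\in N$. $E$ is *integrable* if there is an integral manifold through every point of $U$; it is *uniquely integrable* if it is integrable and the intersection of any two integral manifolds is relatively open in both. For subspaces $F,G$ of equal dimension, $\angle(F,G)$ is the largest principal angle, $\max_{u\in F,|u|=1}\min_{v\in G,|v|=1}\angle(u,v)$. Subbundles $E^k$ converge to $E$ in angle if $\sup_{x\in U}\angle(E_x,E^k_x)\to0$ as $k\to\infty$. **Frames and covers.** Let $\mathcal Y\subseteq\mathbb R^{m+n}$ be a linear subspace (the span of $\partial/\partial y^1,\dots,\partial/\partial y^n$ in some linear coordinates $(x^1,\dots,x^m,y^1,\dots,y^n)$) with $E_p\oplus\mathcal Y=\mathbb R^{m+n}$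 for all $p\in U$, and let $E^k$ be $C^1$ subbundles of rank $m$ on $U$, also transverse to $\mathcal Y$ at every point. A *frame* of $\mathcal A^1(E^k)$ on an open set $O\subseteq U$ is an $n$-tuple $A=(\alpha_1,\dots,\alpha_n)$ of $C^1$ 1-forms on $O$, linearly independent at each point and with common kernel $E^k_p$ at each $p\in O$; it is regarded as a map $A_p:\mathbb R^{m+n}\to\mathbb R^n$. Put $dA=(d\alpha_1,\dots,d\alpha_n)$ and $A_p^{-1}:=(A_p|_{\mathcal Y})^{-1}:\mathbb R^n\to\mathcal Y$. A finite open cover $\{U^{k,i}\}_{i=1}^{s_k}$ of $U$ with frames $A^{k,i}$ of $\mathcal A^1(E^k)$ on $U^{k,i}$ is *compatible* if $\|A^{k,i}_p\circ A^{-k,j}_p\|=1$ for all $i,j$ and all $p\in U^{k,i}\cap U^{k,j}$, where $A_p^{-k,j}:=(A_p^{k,j}|_{\mathcal Y})^{-1}$. Set $$M^{k,i}_A=\sup\{|dA^{k,i}_p(A^{-k,i}_pw,v)|:\ p\in U^{k,i},\ v\in E^k_p,\ w\in\mathbb R^n,\ |v|=|w|=1\},$$ $$\|dA^{k,i}|_{E^k}\|_\infty=\sup\{|dA^{k,i}_p(u,v)|:\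 p\in U^{k,i},\ u,v\in E^k_p,\ |u|=|v|=1\},$$ $$\|A^{-k,j}\|_\infty=\sup_{p\in U^{k,j}}\|A^{-k,j}_p\|,\qquad \|A^{k,i}|_E\|_\infty=\sup\{|A^{k,i}_pu|:\ p\in U^{k,i},\ u\in E_p,\ |u|=1\}.$$ These suprema are taken in $[0,\infty]$, with $e^\infty=\infty$ and $0\cdot\infty=0$. $E$ is *asymptotically involutive* if there are such a $\mathcal Y$, a sequence of $C^1$ subbundles $E^k$ of rank $m$ transverse to $\mathcal Y$ and converging to $E$ in angle, a constant $\epsilon>0$, and for every $k$ a compatible finite open cover $\{U^{k,i}\}_{i=1}^{s_k}$ of $U$ with frames $A^{k,i}$ of $\mathcal A^1(E^k)$, such that $$\max_{i,j,\ell}\ \|dA^{k,i}|_{E^k}\|_\infty\,\|A^{-k,j}\|_\infty\,e^{\epsilon M^{k,\ell}_A}\to0\qquad(k\to\infty).$$ $E$ is *exterior regular* if there are such $\mathcal Y$, $E^k$, $\epsilon>0$, covers and frames $B^{k,i}$ with $$\max_{i,j,\ell}\ \|B^{k,i}|_{E}\|_\infty\,\|B^{-k,j}\|_\infty\,e^{\epsilon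 M^{k,\ell}_B}\to0\qquad(k\to\infty).$$ **Theorem.** If $E$ is asymptotically involutive, then $E$ is integrable. If $E$ is integrable and exterior regular, then $E$ is uniquely integrable. -/

import Mathlib

open Set Filter Topology
open scoped ENNReal

noncomputable section

namespace AsymptoticFrobenius

/-- The Euclidean space `ℝ^d`. -/
abbrev Euc (d : ℕ) : Type := EuclideanSpace ℝ (Fin d)

/-- `E` is a tangent subbundle of rank `m` and class `C^r` on `U`: near every point of `U` it is
spanned by `m` pointwise linearly independent vector fields of class `C^r`.  The values of `E`
outside `U` play no role.  Continuous means `r = 0`. -/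
def IsSubbundle {d : ℕ} (r : WithTop ℕ∞) (m : ℕ) (U : Set (Euc d))
    (E : Euc d → Submodule ℝ (Euc d)) : Prop :=
  ∀ p ∈ U, ∃ (W : Set (Euc d)) (X : Fin m → Euc d → Euc d),
    IsOpen W ∧ p ∈ W ∧ W ⊆ U ∧ (∀ i, ContDiffOn ℝ r (X i) W) ∧
    ∀ q ∈ W, LinearIndependent ℝ (fun i => X i q) ∧
      Submodule.span ℝ (Set.range fun i => X i q) = E q

/-- The angle between two subspaces of the same dimension: the largest, over unit vectors `u` of
`F`, of the smallest angle between `u` and a unit vector of `G` (the largest principal angle). -/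
def subspaceAngle {d : ℕ} (F G : Submodule ℝ (Euc d)) : ℝ :=
  sSup {θ : ℝ | ∃ u ∈ F, ‖u‖ = 1 ∧
    θ = sInf {φ : ℝ | ∃ v ∈ G, ‖v‖ = 1 ∧ φ = InnerProductGeometry.angle u v}}

/-- `sup_{x ∈ U} ∠(E x, Ek k x) → 0` as `k → ∞`. -/
def ConvergesInAngle {d : ℕ} (U : Set (Euc d)) (Ek : ℕ → Euc d → Submodule ℝ (Euc d))
    (E : Euc d → Submodule ℝ (Euc d)) : Prop :=
  ∀ δ : ℝ, 0 < δ → ∀ᶠ k in atTop, ∀ x ∈ U, subspaceAngle (E x) (Ek k x) ≤ δ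

/-- An `n`-tuple of 1-forms on `ℝ^d`, that is, an `ℝ^n`-valued 1-form. -/
abbrev FormTuple (d n : ℕ) : Type := Euc d → Euc d →L[ℝ] Euc n

/-- The exterior derivative `dA_p(u, v) = (dα₁(u, v), …, dαₙ(u, v))` of `A = (α₁, …, αₙ)`. -/
def dForm {d n : ℕ} (A : FormTuple d n) (p u v : Euc d) : Euc n :=
  extDeriv (fun q => ContinuousAlternatingMap.ofSubsingleton ℝ (Euc d) (Euc n) (0 : Fin 1) (A q))
    p ![u, v]

/-- The usual formula for the exterior derivative of a 1-form. -/
theorem dForm_eq {d n : ℕ} (A : FormTuple d n) (p u v : Euc d)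
    (hA : DifferentiableAt ℝ A p) :
    dForm A p u v = fderiv ℝ A p u v - fderiv ℝ A p v u := by
  have hd : DifferentiableAt ℝ (fun q =>
      ContinuousAlternatingMap.ofSubsingleton ℝ (Euc d) (Euc n) (0 : Fin 1) (A q)) p :=
    (LinearIsometryEquiv.toContinuousLinearEquiv (ContinuousAlternatingMap.ofSubsingletonLIE
      (𝕜 := ℝ) (E := Euc d) (F := Euc n) (0 : Fin 1))).differentiableAt.comp p hA
  have key : ∀ a w : Euc d, fderiv ℝ (fun q => A q w) p a = fderiv ℝ A p a w := by
    intro a w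
    rw [fderiv_clm_apply hA (differentiableAt_const w)]
    simp
  rw [dForm, extDeriv_apply hd]
  simp [Fin.sum_univ_two, Fin.removeNth, key, sub_eq_add_neg]

/-- The inverse `(L|_Y)⁻¹ : ℝ^n → Y ⊆ ℝ^d` of a linear map `L` whose restriction to `Y` is
invertible. -/
def transInv {d n : ℕ} (Y : Submodule ℝ (Euc d)) (L : Euc d →L[ℝ] Euc n) : Euc n →L[ℝ] Euc d :=
  Y.subtypeL ∘L ContinuousLinearMap.inverse (L ∘L Y.subtypeL)

/-- `A` is a `C^1` section on the open set `O` of the frame bundle of the annihilator `𝒜¹(E)`: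
its `n` components are `C^1` 1-forms which at each point of `O` are linearly independent and have
`E` as common kernel. -/
def IsAnnihilatorFrame {d n : ℕ} (O : Set (Euc d)) (E : Euc d → Submodule ℝ (Euc d))
    (A : FormTuple d n) : Prop :=
  ContDiffOn ℝ 1 A O ∧ ∀ p ∈ O, Function.Surjective (A p) ∧ (A p).ker = E p

/-- `O 0, …, O (s - 1)` is a finite open cover of `U`, compatible with the sections `A i` of the
frame bundle of `𝒜¹(E)` over `O i`. -/
def IsCompatibleCover {d n s : ℕ} (U : Set (Euc d)) (Y : Submodule ℝ (Euc d))
    (E : Euc d → Submodule ℝ (Euc d)) (O : Fin s → Set (Euc d)) (A : Fin s → FormTuple d n) :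
    Prop :=
  (∀ i, IsOpen (O i)) ∧ (⋃ i, O i) = U ∧ (∀ i, IsAnnihilatorFrame (O i) E (A i)) ∧
  ∀ i j, ∀ p ∈ O i ∩ O j, ‖(A i p) ∘L transInv Y (A j p)‖ = 1

/-- `‖A|_F‖_∞ = sup_{p ∈ O} ‖A_p|_{F p}‖`. -/
def supRestrict {d n : ℕ} (O : Set (Euc d)) (F : Euc d → Submodule ℝ (Euc d))
    (A : FormTuple d n) : ℝ≥0∞ :=
  ⨆ p ∈ O, ⨆ u ∈ F p, ⨆ _ : ‖u‖ = 1, ‖A p u‖ₑ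

/-- `‖dA|_F‖_∞ = sup_{p ∈ O} ‖dA_p|_{F p × F p}‖`. -/
def supDRestrict {d n : ℕ} (O : Set (Euc d)) (F : Euc d → Submodule ℝ (Euc d))
    (A : FormTuple d n) : ℝ≥0∞ :=
  ⨆ p ∈ O, ⨆ u ∈ F p, ⨆ v ∈ F p, ⨆ _ : ‖u‖ = 1, ⨆ _ : ‖v‖ = 1, ‖dForm A p u v‖ₑ

/-- `‖A⁻¹‖_∞ = sup_{p ∈ O} ‖(A_p|_Y)⁻¹‖`. -/
def supInv {d n : ℕ} (O : Set (Euc d)) (Y : Submodule ℝ (Euc d)) (A : FormTuple d n) : ℝ≥0∞ :=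
  ⨆ p ∈ O, ‖transInv Y (A p)‖ₑ

/-- `M_A = sup |dA_p((A_p|_Y)⁻¹ w, v)|` over `p ∈ O` and unit vectors `v ∈ F p`, `w ∈ ℝ^n`. -/
def supMixed {d n : ℕ} (O : Set (Euc d)) (Y : Submodule ℝ (Euc d))
    (F : Euc d → Submodule ℝ (Euc d)) (A : FormTuple d n) : ℝ≥0∞ :=
  ⨆ p ∈ O, ⨆ v ∈ F p, ⨆ w : Euc n, ⨆ _ : ‖v‖ = 1, ⨆ _ : ‖w‖ = 1,
    ‖dForm A p (transInv Y (A p) w) v‖ₑ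

/-- `e^{εM}`, equal to `∞` for `M = ∞`. -/
def expENN (ε : ℝ) (M : ℝ≥0∞) : ℝ≥0∞ :=
  EReal.exp ((ENNReal.ofReal ε * M : ℝ≥0∞) : EReal)

/-- `Ek` is a sequence of `C^1` subbundles of rank `m` on `U`, transverse to `Y`, that converges
to `E` in angle. -/
def IsApproximation {d : ℕ} (m : ℕ) (U : Set (Euc d)) (Y : Submodule ℝ (Euc d))
    (E : Euc d → Submodule ℝ (Euc d)) (Ek : ℕ → Euc d → Submodule ℝ (Euc d)) : Prop :=
  (∀ k, IsSubbundle 1 m U (Ek k)) ∧ (∀ k, ∀ p ∈ U, IsCompl (Ek k p) Y) ∧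
  ConvergesInAngle U Ek E

/-- Asymptotic involutivity of the rank `m` bundle `E` on `U ⊆ ℝ^(m+n)`; `Y` is the span of
`∂/∂y¹, …, ∂/∂yⁿ` for linear coordinates `(x, y)` such that the `y`-directions are transverse to
`E` on `U`. -/
def AsymptoticallyInvolutive (m n : ℕ) (U : Set (Euc (m + n)))
    (E : Euc (m + n) → Submodule ℝ (Euc (m + n))) : Prop :=
  ∃ Y : Submodule ℝ (Euc (m + n)), (∀ p ∈ U, IsCompl (E p) Y) ∧
  ∃ Ek : ℕ → Euc (m + n) → Submodule ℝ (Euc (m + n)), IsApproximation m U Y E Ek ∧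
  ∃ ε : ℝ, 0 < ε ∧
  ∃ (s : ℕ → ℕ) (O : ∀ k, Fin (s k) → Set (Euc (m + n)))
    (A : ∀ k, Fin (s k) → FormTuple (m + n) n),
    (∀ k, IsCompatibleCover U Y (Ek k) (O k) (A k)) ∧
    Tendsto (fun k => ⨆ (i : Fin (s k)) (j : Fin (s k)) (l : Fin (s k)),
      supDRestrict (O k i) (Ek k) (A k i) * supInv (O k j) Y (A k j) *
        expENN ε (supMixed (O k l) Y (Ek k) (A k l))) atTop (𝓝 0)

/-- Exterior regularity of the rank `m` bundle `E` on `U ⊆ ℝ^(m+n)`; `Y` is as in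
`AsymptoticallyInvolutive`. -/
def ExteriorRegular (m n : ℕ) (U : Set (Euc (m + n)))
    (E : Euc (m + n) → Submodule ℝ (Euc (m + n))) : Prop :=
  ∃ Y : Submodule ℝ (Euc (m + n)), (∀ p ∈ U, IsCompl (E p) Y) ∧
  ∃ Ek : ℕ → Euc (m + n) → Submodule ℝ (Euc (m + n)), IsApproximation m U Y E Ek ∧
  ∃ ε : ℝ, 0 < ε ∧
  ∃ (s : ℕ → ℕ) (O : ∀ k, Fin (s k) → Set (Euc (m + n)))
    (B : ∀ k, Fin (s k) → FormTuple (m + n) n),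
    (∀ k, IsCompatibleCover U Y (Ek k) (O k) (B k)) ∧
    Tendsto (fun k => ⨆ (i : Fin (s k)) (j : Fin (s k)) (l : Fin (s k)),
      supRestrict (O k i) E (B k i) * supInv (O k j) Y (B k j) *
        expENN ε (supMixed (O k l) Y (Ek k) (B k l))) atTop (𝓝 0)

/-- `N ⊆ U` is an (embedded, `m`-dimensional, `C^1`) integral manifold of `E`: near each of its
points `p` there is a `C^1` chart `φ` of `ℝ^(m+n)` that maps `N` to the slice `ℝ^m × {0}`, and the
tangent space `T_p N = (Dφ_p)⁻¹(ℝ^m × {0})` is `E p`. -/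
def IsIntegralManifold (m n : ℕ) (U : Set (Euc (m + n)))
    (E : Euc (m + n) → Submodule ℝ (Euc (m + n))) (N : Set (Euc (m + n))) : Prop :=
  N ⊆ U ∧ ∀ p ∈ N, ∃ φ : OpenPartialHomeomorph (Euc (m + n)) (Euc m × Euc n),
    p ∈ φ.source ∧ ContDiffOn ℝ 1 φ φ.source ∧ ContDiffOn ℝ 1 φ.symm φ.target ∧
    (∀ q ∈ φ.source, q ∈ N ↔ (φ q).2 = 0) ∧
    ∀ v, v ∈ E p ↔ (fderiv ℝ φ p v).2 = 0

/-- There is an integral manifold of `E` through every point of `U`. -/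
def Integrable (m n : ℕ) (U : Set (Euc (m + n)))
    (E : Euc (m + n) → Submodule ℝ (Euc (m + n))) : Prop :=
  ∀ p ∈ U, ∃ N, IsIntegralManifold m n U E N ∧ p ∈ N

/-- `E` is integrable, and the intersection of any two integral manifolds of `E` is relatively
open in both of them. -/
def UniquelyIntegrable (m n : ℕ) (U : Set (Euc (m + n)))
    (E : Euc (m + n) → Submodule ℝ (Euc (m + n))) : Prop :=
  Integrable m n U E ∧
  ∀ N₁ N₂, IsIntegralManifold m n U E N₁ → IsIntegralManifold m n U E N₂ →
    IsOpen ((↑) ⁻¹' N₂ : Set N₁) ∧ IsOpen ((↑) ⁻¹' N₁ : Set N₂)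

end AsymptoticFrobenius

end

/-!
A subspace `Y` complementary to all the `E p` turns the search for integral manifolds into a family
of ordinary differential equations. With `π_p` the projection onto `E p` along `Y`, a *lift* of the
direction `ξ` is a solution of `u' = π_u(ξ)` (`IsLift`); an integral manifold through `p₀` is, near
`p₀`, the set of endpoints of the lifts of the radial segments `t ↦ p₀ + t ξ`. The projections onto
a `C^1` bundle are `C^1`, so that the approximating bundles `E^k` have unique lifts, whereas those of
the continuous bundle `E` are a priori not unique.

Everything rests on one estimate for two nearby lifts `u₀`, `u₁` to a `C^1` bundle with annihilator
frame `A` (`transport_estimate`). The `E`-component of `u₁ - u₀` is known explicitly, since lifts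
stay over the segments that they lift. The transverse part `a = |A_{u₀}(u₁ - u₀)|` has, by the
linearised Cartan formula `norm_deriv_apply_sub_le`, a derivative which up to higher order terms is
`dA(u₀', u₁ - u₀)`. Splitting `u₁ - u₀` along `E ⊕ Y` bounds this by `M |u₀'| a` plus a multiple of
`‖dA|_E‖`, and Gronwall's inequality follows. Compatibility of the frames says that `a` is
independent of the chart (`IsCompatibleCover.norm_apply_eq`), so that no constant is lost when `u₀`
passes from one chart to the next, no matter how often (`gronwall_compatible`). Since
`|u₀'| ≤ C |ξ|`, directions with `C |ξ| ≤ ε` suffer a distortion of at most `e^{εM}`.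

*Integrability.* The endpoint map `F` of the radial lifts to `E^k` satisfies
`F ζ - F ξ ≈ π_{F ξ}(ζ - ξ)` with an error controlled by `‖dA|_{E^k}‖ ‖A⁻¹‖ e^{εM}`, which tends
to `0`: it is an approximate leaf (`exists_isApproxLeaf`). Approximate leaves are stated by increments
rather than by derivatives, so that they pass to a pointwise limit along an ultrafilter
(`exists_limit_leaf`). The limit has derivative `π_{F ξ}`, which is continuous, and its graph is an
integral manifold (`exists_integralManifold_of_leaf`).

*Uniqueness.* Any curve `γ` tangent to `E` that lifts a short segment is close to the lift to `E^k`
from the same point (`norm_sub_le_of_supRestrict`): in terms of the flow of `E^k`, the endpoint of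
the lift that starts at `γ s` at time `s` moves with a speed at most
`‖B|_E‖ ‖B⁻¹‖ e^{εM}` up to a constant, because only the part `B(γ')` transverse to `E^k`
contributes. Hence two lifts to `E` from one point agree (`ExteriorRegular.exists_unique_lifts`), and
two integral manifolds with a common point, both swept out by lifts
(`IsIntegralManifold.exists_lifts`), agree near it.

The suprema may be infinite while their product is small, but only if the first factor vanishes;
then compactness supplies finite bounds for the others (`exists_real_bounds`).
-/

namespace AsymptoticFrobenius

/-! ### Projections along the transverse subspace -/

open Classical in
/-- The projection of `ℝ^d` onto `F` along `Y`; it is `0` unless `F` and `Y` are complementary. -/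
noncomputable def projAlong {d : ℕ} (Y F : Submodule ℝ (Euc d)) : Euc d →L[ℝ] Euc d :=
  if h : IsCompl F Y then LinearMap.toContinuousLinearMap (F.projection Y h) else 0

section Projection

variable {d n : ℕ} {Y F : Submodule ℝ (Euc d)}

theorem projAlong_mem (h : IsCompl F Y) (v : Euc d) : projAlong Y F v ∈ F := by
  simp only [projAlong, dif_pos h, LinearMap.coe_toContinuousLinearMap']
  exact Submodule.projection_apply_mem h v

theorem projAlong_eq_zero (h : IsCompl F Y) {v : Euc d} (hv : v ∈ Y) : projAlong Y F v = 0 := by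
  simp only [projAlong, dif_pos h, LinearMap.coe_toContinuousLinearMap']
  exact Submodule.projection_apply_of_mem_right h hv

theorem projAlong_eq_self (h : IsCompl F Y) {v : Euc d} (hv : v ∈ F) : projAlong Y F v = v := by
  simp only [projAlong, dif_pos h, LinearMap.coe_toContinuousLinearMap']
  exact Submodule.projection_apply_of_mem_left h hv

theorem projAlong_eq_of_sub_mem (h : IsCompl F Y) {v w : Euc d} (hw : v - w ∈ Y) :
    projAlong Y F v = projAlong Y F w := by
  have := projAlong_eq_zero h hw
  rwa [map_sub, sub_eq_zero] at this

theorem projAlong_eq_of_mem (h : IsCompl F Y) {u v : Euc d} (hu : u ∈ F) (huv : u - v ∈ Y) :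
    projAlong Y F v = u := by
  rw [← projAlong_eq_of_sub_mem h huv, projAlong_eq_self h hu]

theorem sub_projAlong_mem (h : IsCompl F Y) (v : Euc d) : v - projAlong Y F v ∈ Y := by
  rw [← Submodule.projection_apply_eq_zero_iff h]
  have h1 : F.projection Y h (v - projAlong Y F v) = projAlong Y F (v - projAlong Y F v) := by
    simp only [projAlong, dif_pos h, LinearMap.coe_toContinuousLinearMap']
  rw [h1, map_sub, projAlong_eq_self h (projAlong_mem h v), sub_self]

theorem projAlong_eq_zero_iff (h : IsCompl F Y) {v : Euc d} : projAlong Y F v = 0 ↔ v ∈ Y := by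
  refine ⟨fun hv => ?_, projAlong_eq_zero h⟩
  simpa [hv] using sub_projAlong_mem h v

theorem projAlong_eq_self_iff (h : IsCompl F Y) {v : Euc d} : projAlong Y F v = v ↔ v ∈ F :=
  ⟨fun hv => hv ▸ projAlong_mem h v, projAlong_eq_self h⟩

variable {L : Euc d →L[ℝ] Euc n}

/-- The restriction to `Y` of a surjective map whose kernel is complementary to `Y` is
invertible. -/
theorem isInvertible_comp_subtypeL (h : IsCompl F Y) (hL : Function.Surjective L)
    (hk : L.ker = F) : (L ∘L Y.subtypeL).IsInvertible := by
  have hinj : Function.Injective (L ∘L Y.subtypeL : Y →L[ℝ] Euc n) := by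
    rw [injective_iff_map_eq_zero]
    intro y hy
    have h1 : (y : Euc d) ∈ F := by rw [← hk]; simpa using hy
    have := h.disjoint.le_bot ⟨h1, y.2⟩
    simpa using this
  have hsurj : Function.Surjective (L ∘L Y.subtypeL : Y →L[ℝ] Euc n) := by
    intro w
    obtain ⟨v, rfl⟩ := hL w
    refine ⟨⟨v - projAlong Y F v, sub_projAlong_mem h v⟩, ?_⟩
    have h1 : projAlong Y F v ∈ L.ker := by rw [hk]; exact projAlong_mem h v
    have h2 : L (projAlong Y F v) = 0 := by simpa using h1
    simp [h2]
  refine ⟨(LinearEquiv.ofBijective (L ∘L Y.subtypeL : Y →L[ℝ] Euc n).toLinearMap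
    ⟨hinj, hsurj⟩).toContinuousLinearEquiv, ?_⟩
  ext; rfl

theorem transInv_mem (w : Euc n) : transInv Y L w ∈ Y := by
  simp [transInv]

theorem apply_transInv (h : IsCompl F Y) (hL : Function.Surjective L) (hk : L.ker = F)
    (w : Euc n) : L (transInv Y L w) = w :=
  (isInvertible_comp_subtypeL h hL hk).self_apply_inverse w

theorem apply_projAlong (h : IsCompl F Y) (hk : L.ker = F) (v : Euc d) :
    L (projAlong Y F v) = 0 := by
  have h1 : projAlong Y F v ∈ L.ker := by rw [hk]; exact projAlong_mem h v
  simpa using h1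

/-- The splitting `v = π v + A⁻¹ (A v)` along `ker A ⊕ Y`. -/
theorem transInv_apply (h : IsCompl F Y) (hL : Function.Surjective L) (hk : L.ker = F)
    (v : Euc d) : transInv Y L (L v) = v - projAlong Y F v := by
  have h1 : L (transInv Y L (L v) - v) = 0 := by
    rw [map_sub, apply_transInv h hL hk, sub_self]
  have h2 : v - transInv Y L (L v) ∈ F := by
    rw [← hk]
    have : L (v - transInv Y L (L v)) = 0 := by rw [← neg_sub, map_neg, h1, neg_zero]
    simpa using this
  have h3 : projAlong Y F v = v - transInv Y L (L v) := by
    apply projAlong_eq_of_mem h h2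
    have : v - transInv Y L (L v) - v = - transInv Y L (L v) := by abel
    rw [this]
    exact Y.neg_mem (transInv_mem _)
  rw [h3]; abel

theorem projAlong_eq_id_sub (h : IsCompl F Y) (hL : Function.Surjective L) (hk : L.ker = F) :
    projAlong Y F = ContinuousLinearMap.id ℝ _ - transInv Y L ∘L L := by
  ext1 v
  simp [transInv_apply h hL hk]

end Projection

section Frame

variable {d n s : ℕ} {U : Set (Euc d)} {Y : Submodule ℝ (Euc d)}
  {E : Euc d → Submodule ℝ (Euc d)}

theorem IsAnnihilatorFrame.contDiffOn_transInv {O : Set (Euc d)} {A : FormTuple d n}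
    (hA : IsAnnihilatorFrame O E A) (hE : ∀ p ∈ O, IsCompl (E p) Y) :
    ContDiffOn ℝ 1 (fun p => transInv Y (A p)) O := by
  intro p hp
  have h1 : ContDiffWithinAt ℝ 1 (fun q => A q ∘L Y.subtypeL) O p :=
    (hA.1 p hp).clm_comp contDiffWithinAt_const
  have h2 := (isInvertible_comp_subtypeL (hE p hp) (hA.2 p hp).1
    (hA.2 p hp).2).contDiffAt_map_inverse (n := 1)
  have h3 : ContDiffWithinAt ℝ 1
      (fun q => ContinuousLinearMap.inverse (A q ∘L Y.subtypeL)) O p :=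
    ContDiffAt.comp_contDiffWithinAt (g := ContinuousLinearMap.inverse) p h2 h1
  exact contDiffWithinAt_const.clm_comp h3

theorem IsAnnihilatorFrame.contDiffOn_projAlong {O : Set (Euc d)} {A : FormTuple d n}
    (hA : IsAnnihilatorFrame O E A) (hE : ∀ p ∈ O, IsCompl (E p) Y) :
    ContDiffOn ℝ 1 (fun p => projAlong Y (E p)) O := by
  have h : ContDiffOn ℝ 1
      (fun p => ContinuousLinearMap.id ℝ (Euc d) - transInv Y (A p) ∘L A p) O :=
    contDiffOn_const.sub ((hA.contDiffOn_transInv hE).clm_comp hA.1)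
  exact h.congr fun p hp => projAlong_eq_id_sub (hE p hp) (hA.2 p hp).1 (hA.2 p hp).2

variable {O : Fin s → Set (Euc d)} {A : Fin s → FormTuple d n}

theorem IsCompatibleCover.subset (hc : IsCompatibleCover U Y E O A) (i : Fin s) : O i ⊆ U := by
  rw [← hc.2.1]; exact subset_iUnion O i

theorem IsCompatibleCover.exists_mem (hc : IsCompatibleCover U Y E O A) {p : Euc d}
    (hp : p ∈ U) : ∃ i, p ∈ O i := by
  rw [← hc.2.1] at hp; exact mem_iUnion.1 hp

theorem IsCompatibleCover.contDiffOn_projAlong (hc : IsCompatibleCover U Y E O A)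
    (hE : ∀ p ∈ U, IsCompl (E p) Y) : ContDiffOn ℝ 1 (fun p => projAlong Y (E p)) U := by
  intro p hp
  obtain ⟨i, hi⟩ := hc.exists_mem hp
  exact (((hc.2.2.1 i).contDiffOn_projAlong fun q hq => hE q (hc.subset i hq)).contDiffAt
    ((hc.1 i).mem_nhds hi)).contDiffWithinAt

/-- The norm of `A_p v` does not depend on the frame: compatible frames differ by isometries of
`ℝ^n`. -/
theorem IsCompatibleCover.norm_apply_eq (hc : IsCompatibleCover U Y E O A)
    (hE : ∀ p ∈ U, IsCompl (E p) Y) {p : Euc d} {i j : Fin s} (hi : p ∈ O i) (hj : p ∈ O j)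
    (v : Euc d) : ‖A i p v‖ = ‖A j p v‖ := by
  have key : ∀ i j : Fin s, p ∈ O i → p ∈ O j → ‖A i p v‖ ≤ ‖A j p v‖ := by
    intro i j hi hj
    have hp := hE p (hc.subset i hi)
    obtain ⟨-, hki⟩ := (hc.2.2.1 i).2 p hi
    obtain ⟨hsj, hkj⟩ := (hc.2.2.1 j).2 p hj
    have h1 : A i p v = (A i p ∘L transInv Y (A j p)) (A j p v) := by
      rw [ContinuousLinearMap.comp_apply, transInv_apply hp hsj hkj, map_sub,
        apply_projAlong hp hki, sub_zero]
    calc ‖A i p v‖ ≤ ‖A i p ∘L transInv Y (A j p)‖ * ‖A j p v‖ := by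
          rw [h1]; exact ContinuousLinearMap.le_opNorm _ _
      _ = ‖A j p v‖ := by rw [hc.2.2.2 i j p ⟨hi, hj⟩, one_mul]
  exact le_antisymm (key i j hi hj) (key j i hj hi)

end Frame

/-! ### Calculus on compact sets -/

section Calculus

variable {V G : Type*} [NormedAddCommGroup V] [NormedSpace ℝ V] [FiniteDimensional ℝ V]
  [NormedAddCommGroup G] [NormedSpace ℝ G]

/-- A `C^1` map is differentiable uniformly on compact sets. -/
theorem exists_uniform_taylor {O K : Set V} (hO : IsOpen O) (hK : IsCompact K) (hKO : K ⊆ O)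
    {f : V → G} (hf : ContDiffOn ℝ 1 f O) {η : ℝ} (hη : 0 < η) :
    ∃ δ > 0, ∀ q ∈ K, ∀ p, dist p q < δ →
      p ∈ O ∧ ‖f p - f q - fderiv ℝ f q (p - q)‖ ≤ η * ‖p - q‖ := by
  have := FiniteDimensional.proper ℝ V
  obtain ⟨δ₁, hδ₁, hth⟩ := hK.exists_cthickening_subset_open hO hKO
  have hcont : ContinuousOn (fderiv ℝ f) (Metric.cthickening δ₁ K) :=
    (hf.continuousOn_fderiv_of_isOpen hO le_rfl).mono hth
  have huc := hK.cthickening (r := δ₁) |>.uniformContinuousOn_of_continuous hcont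
  obtain ⟨δ₂, hδ₂, hu⟩ := Metric.uniformContinuousOn_iff.1 huc η hη
  have hmem : ∀ q ∈ K, ∀ p, dist p q < min δ₁ δ₂ → p ∈ Metric.cthickening δ₁ K := by
    intro q hq p hp
    exact Metric.mem_cthickening_of_dist_le p q δ₁ K hq (hp.le.trans (min_le_left _ _))
  refine ⟨min δ₁ δ₂, lt_min hδ₁ hδ₂, fun q hq p hp => ⟨hth (hmem q hq p hp), ?_⟩⟩
  have hq' : q ∈ Metric.ball q (min δ₁ δ₂) := Metric.mem_ball_self (lt_min hδ₁ hδ₂)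
  refine Convex.norm_image_sub_le_of_norm_fderiv_le' (𝕜 := ℝ) (s := Metric.ball q (min δ₁ δ₂))
    (fun x hx => ?_) (fun x hx => ?_) (convex_ball _ _) hq' hp
  · exact (hf.contDiffAt (hO.mem_nhds (hth (hmem q hq x hx)))).differentiableAt one_ne_zero
  · rw [← dist_eq_norm]
    refine (hu x (hmem q hq x hx) q (hmem q hq q hq') ?_).le
    exact lt_of_lt_of_le hx (min_le_right _ _)

theorem gronwallBound_le_exp {δ K ε x : ℝ} (hK : 0 ≤ K) (hε : 0 ≤ ε) :
    gronwallBound δ K ε x ≤ (δ + ε * x) * Real.exp (K * x) := by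
  rcases hK.eq_or_lt with rfl | hK
  · simp [gronwallBound_K0]
  · rw [gronwallBound_of_K_ne_0 hK.ne']
    have h1 : Real.exp (K * x) - 1 ≤ K * x * Real.exp (K * x) := by
      have h2 := Real.add_one_le_exp (-(K * x))
      have h3 := Real.exp_pos (K * x)
      have h4 : Real.exp (-(K * x)) * Real.exp (K * x) = 1 := by
        rw [← Real.exp_add]; simp
      nlinarith
    have h5 : ε / K * (Real.exp (K * x) - 1) ≤ ε / K * (K * x * Real.exp (K * x)) := by gcongr
    have h6 : ε / K * (K * x * Real.exp (K * x)) = ε * x * Real.exp (K * x) := by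
      field_simp
    calc δ * Real.exp (K * x) + ε / K * (Real.exp (K * x) - 1)
        ≤ δ * Real.exp (K * x) + ε * x * Real.exp (K * x) := by rw [← h6]; gcongr
      _ = _ := by ring

/-- A uniform bound `c * h` for the increments over all sufficiently short steps of length `h`
bounds the total increment. -/
theorem norm_sub_le_of_small_steps {V : Type*} [SeminormedAddCommGroup V] {φ : ℝ → V} {c h₀ : ℝ}
    (h₀pos : 0 < h₀)
    (hφ : ∀ s h, 0 ≤ s → 0 ≤ h → s + h ≤ 1 → h ≤ h₀ → ‖φ (s + h) - φ s‖ ≤ c * h) :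
    ‖φ 1 - φ 0‖ ≤ c := by
  obtain ⟨N, hN⟩ := exists_nat_gt (1 / h₀)
  have hN0 : (0 : ℝ) < N := lt_trans (by positivity) hN
  have hstep : (1 : ℝ) / N ≤ h₀ := by
    rw [div_le_iff₀ hN0]
    rw [div_lt_iff₀ h₀pos] at hN
    linarith
  have key : ∀ j : ℕ, j ≤ N → ‖φ (j / N) - φ 0‖ ≤ c * (j / N) := by
    intro j
    induction j with
    | zero => simp
    | succ j ih =>
      intro hj
      have h1 := ih (by omega)
      have hj' : ((j : ℝ) + 1) ≤ N := by exact_mod_cast hj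
      have h2 := hφ (j / N) (1 / N) (by positivity) (by positivity)
        (by rw [← add_div, div_le_one hN0]; exact hj') hstep
      have h3 : ((j + 1 : ℕ) : ℝ) / N = j / N + 1 / N := by push_cast; ring
      rw [h3]
      calc ‖φ (j / N + 1 / N) - φ 0‖
          ≤ ‖φ (j / N + 1 / N) - φ (j / N)‖ + ‖φ (j / N) - φ 0‖ :=
            norm_sub_le_norm_sub_add_norm_sub _ _ _
        _ ≤ c * (1 / N) + c * (j / N) := add_le_add h2 h1
        _ = c * (j / N + 1 / N) := by ring
  have := key N le_rfl
  rwa [div_self hN0.ne', mul_one] at this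

end Calculus

/-! ### Horizontal lifts of segments -/

/-- `u : [0, T] → K` is a solution of `u' = π_u(ξ)`, where `π_p` is the projection onto `E p`
along `Y`: a curve tangent to `E` which lifts the segment `t ↦ u 0 + t ξ` of `ℝ^d / Y`. -/
def IsLift {d : ℕ} (Y : Submodule ℝ (Euc d)) (E : Euc d → Submodule ℝ (Euc d))
    (K : Set (Euc d)) (ξ : Euc d) (T : ℝ) (u : ℝ → Euc d) : Prop :=
  ∀ t ∈ Icc 0 T, u t ∈ K ∧ HasDerivWithinAt u (projAlong Y (E (u t)) ξ) (Icc 0 T) t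

section Lift

variable {d : ℕ} {Y : Submodule ℝ (Euc d)} {E : Euc d → Submodule ℝ (Euc d)} {K : Set (Euc d)}
  {ξ ξ₀ ξ₁ : Euc d} {T : ℝ} {u u₀ u₁ : ℝ → Euc d}

theorem IsLift.continuousOn (hu : IsLift Y E K ξ T u) : ContinuousOn u (Icc 0 T) :=
  fun t ht => (hu t ht).2.continuousWithinAt

theorem IsLift.hasDerivWithinAt_Ici (hu : IsLift Y E K ξ T u) {t : ℝ} (ht : t ∈ Ico 0 T) :
    HasDerivWithinAt u (projAlong Y (E (u t)) ξ) (Ici t) t :=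
  (hu t (Ico_subset_Icc_self ht)).2.mono_of_mem_nhdsWithin (Icc_mem_nhdsGE_of_mem ht)

theorem IsLift.mono (hu : IsLift Y E K ξ T u) {T' : ℝ} (h : T' ≤ T) : IsLift Y E K ξ T' u :=
  fun t ht => ⟨(hu t ⟨ht.1, ht.2.trans h⟩).1,
    (hu t ⟨ht.1, ht.2.trans h⟩).2.mono (Icc_subset_Icc_right h)⟩

theorem IsLift.shift (hu : IsLift Y E K ξ T u) {a T' : ℝ} (ha : 0 ≤ a) (h : T' + a ≤ T) :
    IsLift Y E K ξ T' (fun t => u (t + a)) := by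
  intro t ht
  have hmem : t + a ∈ Icc 0 T := ⟨by linarith [ht.1], by linarith [ht.2]⟩
  refine ⟨(hu _ hmem).1, ?_⟩
  have h1 : HasDerivWithinAt (fun t : ℝ => t + a) 1 (Icc 0 T') t :=
    ((hasDerivAt_id t).add_const a).hasDerivWithinAt
  have h2 := (hu _ hmem).2.scomp t h1
    (fun s hs => (⟨by linarith [hs.1], by linarith [hs.2]⟩ : s + a ∈ Icc 0 T))
  simpa using! h2

/-- A lift stays over the segment it lifts. -/
theorem IsLift.sub_mem (hu : IsLift Y E K ξ T u) (hE : ∀ q ∈ K, IsCompl (E q) Y) {t : ℝ}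
    (ht : t ∈ Icc 0 T) : u t - (u 0 + t • ξ) ∈ Y := by
  have h0 : (0 : ℝ) ∈ Icc 0 T := ⟨le_rfl, ht.1.trans ht.2⟩
  -- the fixed projection `P` has kernel `Y`, and `P (u s - s • ξ)` is constant
  set P := projAlong Y (E (u 0))
  have hP := hE _ (hu 0 h0).1
  have hd : ∀ s ∈ Ico 0 T, HasDerivWithinAt (fun s => P (u s - s • ξ)) 0 (Ici s) s := by
    intro s hs
    have h1 := (hu.hasDerivWithinAt_Ici hs).sub
      (((hasDerivAt_id s).smul_const ξ).hasDerivWithinAt (s := Ici s))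
    have h2 := P.hasFDerivAt.comp_hasDerivWithinAt s h1
    have h3 : P (projAlong Y (E (u s)) ξ - (1 : ℝ) • ξ) = 0 := by
      apply projAlong_eq_zero hP
      rw [one_smul, ← neg_sub]
      exact Y.neg_mem (sub_projAlong_mem (hE _ (hu s (Ico_subset_Icc_self hs)).1) ξ)
    rw [h3] at h2
    exact h2
  have hc : ContinuousOn (fun s => P (u s - s • ξ)) (Icc 0 T) :=
    P.continuous.comp_continuousOn (hu.continuousOn.sub (by fun_prop))
  have := constant_of_has_deriv_right_zero hc hd t ht
  rw [← projAlong_eq_zero_iff hP]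
  simp only [zero_smul, sub_zero] at this
  have h4 : u t - (u 0 + t • ξ) = (u t - t • ξ) - u 0 := by abel
  rw [h4, map_sub, this, sub_self]

/-- The `E`-component of the difference of two lifts is that of the lifted segments. -/
theorem IsLift.projAlong_sub (hu₀ : IsLift Y E K ξ₀ T u₀) (hu₁ : IsLift Y E K ξ₁ T u₁)
    (hE : ∀ q ∈ K, IsCompl (E q) Y) {t : ℝ} (ht : t ∈ Icc 0 T) {F : Submodule ℝ (Euc d)}
    (hF : IsCompl F Y) :
    projAlong Y F (u₁ t - u₀ t) = projAlong Y F (u₁ 0 - u₀ 0 + t • (ξ₁ - ξ₀)) := by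
  apply projAlong_eq_of_sub_mem hF
  have := Y.sub_mem (hu₁.sub_mem hE ht) (hu₀.sub_mem hE ht)
  convert this using 1
  rw [smul_sub]; abel

theorem norm_projAlong_sub_le {C ρ : ℝ} {L : NNReal} {p q : Euc d}
    (hL : LipschitzOnWith L (fun q => projAlong Y (E q)) K)
    (hC : ∀ q ∈ K, ‖projAlong Y (E q)‖ ≤ C) (hρ : ‖ξ₀‖ ≤ ρ) (hp : p ∈ K) (hq : q ∈ K) :
    ‖projAlong Y (E p) ξ₁ - projAlong Y (E q) ξ₀‖ ≤ L * ρ * ‖p - q‖ + C * ‖ξ₁ - ξ₀‖ := by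
  have h1 : projAlong Y (E p) ξ₁ - projAlong Y (E q) ξ₀
      = (projAlong Y (E p) - projAlong Y (E q)) ξ₀ + projAlong Y (E p) (ξ₁ - ξ₀) := by
    simp only [_root_.sub_apply, map_sub]; abel
  rw [h1]
  refine (norm_add_le _ _).trans (add_le_add ?_ ?_)
  · calc _ ≤ ‖projAlong Y (E p) - projAlong Y (E q)‖ * ‖ξ₀‖ :=
          ContinuousLinearMap.le_opNorm _ _
      _ ≤ (L * ‖p - q‖) * ρ := by gcongr; exact hL.norm_sub_le hp hq
      _ = _ := by ring
  · exact ContinuousLinearMap.le_of_opNorm_le _ (hC _ hp) _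

/-- Lifts depend Lipschitz-continuously on the initial point and the direction. -/
theorem IsLift.norm_sub_le (hu₀ : IsLift Y E K ξ₀ T u₀) (hu₁ : IsLift Y E K ξ₁ T u₁)
    {C ρ : ℝ} {L : NNReal} (hT : T ≤ 1)
    (hL : LipschitzOnWith L (fun q => projAlong Y (E q)) K)
    (hC : ∀ q ∈ K, ‖projAlong Y (E q)‖ ≤ C) (hρ : ‖ξ₀‖ ≤ ρ) {t : ℝ} (ht : t ∈ Icc 0 T) :
    ‖u₁ t - u₀ t‖ ≤ (‖u₁ 0 - u₀ 0‖ + C * ‖ξ₁ - ξ₀‖) * Real.exp (L * ρ) := by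
  have hC0 : 0 ≤ C := (norm_nonneg _).trans (hC _ (hu₀ t ht).1)
  have hρ0 : 0 ≤ ρ := (norm_nonneg _).trans hρ
  have hd : ∀ s ∈ Ico 0 T, HasDerivWithinAt (fun s => u₁ s - u₀ s)
      (projAlong Y (E (u₁ s)) ξ₁ - projAlong Y (E (u₀ s)) ξ₀) (Ici s) s :=
    fun s hs => (hu₁.hasDerivWithinAt_Ici hs).sub (hu₀.hasDerivWithinAt_Ici hs)
  have hb : ∀ s ∈ Ico 0 T, ‖projAlong Y (E (u₁ s)) ξ₁ - projAlong Y (E (u₀ s)) ξ₀‖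
      ≤ (L * ρ) * ‖u₁ s - u₀ s‖ + C * ‖ξ₁ - ξ₀‖ := by
    intro s hs
    have hs' := Ico_subset_Icc_self hs
    exact norm_projAlong_sub_le hL hC hρ (hu₁ s hs').1 (hu₀ s hs').1
  have := norm_le_gronwallBound_of_norm_deriv_right_le (f := fun s => u₁ s - u₀ s)
    (hu₁.continuousOn.sub hu₀.continuousOn) hd le_rfl hb t ht
  refine this.trans ((gronwallBound_le_exp (by positivity) (by positivity)).trans ?_)
  have ht1 : t - 0 ≤ 1 := by linarith [ht.2]
  have ht0 : 0 ≤ t - 0 := by linarith [ht.1]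
  have h5 : C * ‖ξ₁ - ξ₀‖ * (t - 0) ≤ C * ‖ξ₁ - ξ₀‖ :=
    mul_le_of_le_one_right (by positivity) ht1
  have h6 : L * ρ * (t - 0) ≤ L * ρ := mul_le_of_le_one_right (by positivity) ht1
  gcongr

/-- The Picard-Lindelöf theorem, with the information that the solution stays in the ball. -/
theorem exists_solution_mem_closedBall {V : Type*} [NormedAddCommGroup V] [NormedSpace ℝ V]
    [CompleteSpace V] {f : ℝ → V → V} {a b : ℝ} {t₀ : Icc a b} {x₀ x : V} {R r M L : NNReal}
    (hf : IsPicardLindelof f t₀ x₀ R r M L) (hx : x ∈ Metric.closedBall x₀ r) :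
    ∃ α : ℝ → V, α t₀ = x ∧ ∀ t ∈ Icc a b, α t ∈ Metric.closedBall x₀ R ∧
      HasDerivWithinAt α (f t (α t)) (Icc a b) t := by
  obtain ⟨α, hα⟩ := ODE.FunSpace.exists_isFixedPt_next hf hx
  have hmem : ∀ t, α.compProj t ∈ Metric.closedBall x₀ R := fun t =>
    α.compProj_mem_closedBall hf.mul_max_le
  refine ⟨α.compProj, by rw [ODE.FunSpace.compProj_val, ← hα, ODE.FunSpace.next_apply₀],
    fun t ht => ⟨hmem t, ?_⟩⟩
  apply ODE.hasDerivWithinAt_picard_Icc t₀.2 hf.continuousOn_uncurry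
    α.continuous_compProj.continuousOn (fun t' _ => hmem t') x ht |>.congr_of_mem _ ht
  intro t' ht'
  nth_rw 1 [← hα]
  rw [ODE.FunSpace.compProj_of_mem ht', ODE.FunSpace.next_apply]

/-- Existence of lifts for a Lipschitz bundle: a speed of at most `C ρ ≤ r / 2` keeps a lift that
starts in the smaller ball inside the larger one. -/
theorem exists_isLift {p₀ p : Euc d} {r C ρ : ℝ} {L : NNReal}
    (hL : LipschitzOnWith L (fun q => projAlong Y (E q)) (Metric.closedBall p₀ r))
    (hC : ∀ q ∈ Metric.closedBall p₀ r, ‖projAlong Y (E q)‖ ≤ C) (hC0 : 0 ≤ C)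
    (hr : 0 ≤ r) (hCρ : C * ρ ≤ r / 2) (hp : p ∈ Metric.closedBall p₀ (r / 2)) (hξ : ‖ξ‖ ≤ ρ) :
    ∃ u, u 0 = p ∧ IsLift Y E (Metric.closedBall p₀ r) ξ 1 u := by
  have hρ0 : 0 ≤ ρ := (norm_nonneg _).trans hξ
  lift r to NNReal using hr
  lift C to NNReal using hC0
  lift ρ to NNReal using hρ0
  have hb : ∀ x ∈ Metric.closedBall p₀ (r : ℝ),
      ‖projAlong Y (E x) ξ‖ ≤ ((C * ρ : NNReal) : ℝ) := fun x hx =>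
    (ContinuousLinearMap.le_of_opNorm_le _ (hC x hx) ξ).trans (by push_cast; gcongr)
  have hl : LipschitzOnWith (L * ‖ξ‖₊) (fun q => projAlong Y (E q) ξ)
      (Metric.closedBall p₀ r) := by
    refine LipschitzOnWith.of_dist_le_mul fun x hx y hy => ?_
    rw [dist_eq_norm, dist_eq_norm, ← _root_.sub_apply]
    calc _ ≤ ‖projAlong Y (E x) - projAlong Y (E y)‖ * ‖ξ‖ := ContinuousLinearMap.le_opNorm _ _
      _ ≤ (L * ‖x - y‖) * ‖ξ‖ := by gcongr; exact hL.norm_sub_le hx hy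
      _ = _ := by push_cast; ring
  have hpl : IsPicardLindelof (fun _ : ℝ => fun q => projAlong Y (E q) ξ)
      (⟨0, by simp⟩ : Icc (0 : ℝ) 1) p₀ r (r / 2) (C * ρ) (L * ‖ξ‖₊) := by
    refine IsPicardLindelof.of_time_independent hb hl ?_
    simp
    linarith
  exact exists_solution_mem_closedBall hpl (by simpa using hp)

end Lift

/-! ### Transport of the annihilator along lifts -/

section Transport

variable {d n s : ℕ} {U : Set (Euc d)} {Y : Submodule ℝ (Euc d)}
  {E : Euc d → Submodule ℝ (Euc d)} {O : Fin s → Set (Euc d)} {A : Fin s → FormTuple d n}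

/-- The derivative of `A_{u₀}(u₁ - u₀)` along two curves tangent to `ker A`: up to terms of second
order in `p - q = u₁ - u₀` it is `dA(v₀, p - q)`, a linearised form of Cartan's formula. -/
theorem norm_deriv_apply_sub_le {A : FormTuple d n} {p q v₀ v₁ : Euc d} {η b : ℝ}
    (hd : DifferentiableAt ℝ A q) (h₀ : A q v₀ = 0) (h₁ : A p v₁ = 0)
    (htaylor : ‖A p - A q - fderiv ℝ A q (p - q)‖ ≤ η * ‖p - q‖)
    (hb : ‖dForm A q v₀ (p - q)‖ ≤ b) :
    ‖fderiv ℝ A q v₀ (p - q) + A q (v₁ - v₀)‖ ≤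
      b + (η * ‖p - q‖ * ‖v₁‖ + ‖fderiv ℝ A q‖ * ‖p - q‖ * ‖v₁ - v₀‖) := by
  have key : fderiv ℝ A q v₀ (p - q) + A q (v₁ - v₀) = dForm A q v₀ (p - q) -
      ((A p - A q - fderiv ℝ A q (p - q)) v₁ + fderiv ℝ A q (p - q) (v₁ - v₀)) := by
    rw [dForm_eq A q _ _ hd]
    simp only [_root_.sub_apply, map_sub, h₀, h₁]
    abel
  rw [key]
  refine (norm_sub_le _ _).trans (add_le_add hb ((norm_add_le _ _).trans (add_le_add ?_ ?_)))
  · exact ContinuousLinearMap.le_of_opNorm_le _ htaylor _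
  · exact ContinuousLinearMap.le_of_opNorm_le _ (ContinuousLinearMap.le_opNorm _ _) _

/-- A Gronwall inequality for `‖A_{u₀}(w)‖` along a curve `u₀` which is allowed to pass from one
chart of a compatible cover to another: the norm does not depend on the frame, and Gronwall's
inequality needs only a bound on right derivatives at each point. -/
theorem gronwall_compatible (hc : IsCompatibleCover U Y E O A)
    (hE : ∀ p ∈ U, IsCompl (E p) Y) {T κ ε : ℝ} (hT : 0 ≤ T) (hT1 : T ≤ 1) (hκ : 0 ≤ κ)
    (hε : 0 ≤ ε) {u w u' w' : ℝ → Euc d} (hu : ContinuousOn u (Icc 0 T))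
    (hw : ContinuousOn w (Icc 0 T)) (huU : ∀ t ∈ Icc 0 T, u t ∈ U)
    (hu' : ∀ t ∈ Ico 0 T, HasDerivWithinAt u (u' t) (Ici t) t)
    (hw' : ∀ t ∈ Ico 0 T, HasDerivWithinAt w (w' t) (Ici t) t)
    (hb : ∀ t ∈ Ico 0 T, ∃ i, u t ∈ O i ∧
      ‖fderiv ℝ (A i) (u t) (u' t) (w t) + A i (u t) (w' t)‖ ≤ κ * ‖A i (u t) (w t)‖ + ε)
    {i j : Fin s} (hi : u 0 ∈ O i) (hj : u T ∈ O j) :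
    ‖A j (u T) (w T)‖ ≤ (‖A i (u 0) (w 0)‖ + ε) * Real.exp κ := by
  -- the chart used at time `t` jumps with `t`, but the norm `a t` does not depend on the choice
  have hidx : ∀ t, ∃ l, t ∈ Icc 0 T → u t ∈ O l := by
    intro t
    by_cases ht : t ∈ Icc 0 T
    · obtain ⟨l, hl⟩ := hc.exists_mem (huU t ht)
      exact ⟨l, fun _ => hl⟩
    · exact ⟨i, fun h => absurd h ht⟩
  choose idx hidx using hidx
  set a : ℝ → ℝ := fun t => ‖A (idx t) (u t) (w t)‖ with ha
  have haeq : ∀ t ∈ Icc 0 T, ∀ l, u t ∈ O l → a t = ‖A l (u t) (w t)‖ := fun t ht l hl =>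
    hc.norm_apply_eq hE (hidx t ht) hl _
  have hloc : ∀ t ∈ Icc 0 T, ∀ l, u t ∈ O l →
      ∀ᶠ z in 𝓝[Icc 0 T] t, a z = ‖A l (u z) (w z)‖ := by
    intro t ht l hl
    filter_upwards [(hu t ht).eventually ((hc.1 l).mem_nhds hl), self_mem_nhdsWithin] with z hz hzT
    exact haeq z hzT l hz
  have hcont : ContinuousOn a (Icc 0 T) := by
    intro t ht
    have hl := hidx t ht
    have h1 : ContinuousAt (A (idx t)) (u t) :=
      ((hc.2.2.1 _).1.continuousOn).continuousAt ((hc.1 _).mem_nhds hl)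
    have h2 : ContinuousWithinAt (fun z => A (idx t) (u z)) (Icc 0 T) t :=
      h1.comp_continuousWithinAt (hu t ht)
    exact ((h2.clm_apply (hw t ht)).norm).congr_of_eventuallyEq (hloc t ht _ hl) rfl
  have : Nonempty (Fin s) := ⟨i⟩
  choose! l hlO hlb using hb
  have hderiv : ∀ t ∈ Ico 0 T, ∀ r,
      ‖fderiv ℝ (A (l t)) (u t) (u' t) (w t) + A (l t) (u t) (w' t)‖ < r →
      ∃ᶠ z in 𝓝[>] t, (z - t)⁻¹ * (a z - a t) < r := by
    intro t ht r hr
    have htI := Ico_subset_Icc_self ht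
    have hdA : HasFDerivAt (A (l t)) (fderiv ℝ (A (l t)) (u t)) (u t) :=
      (((hc.2.2.1 _).1.contDiffAt ((hc.1 _).mem_nhds (hlO t ht))).differentiableAt
        one_ne_zero).hasFDerivAt
    have h1 := (hdA.comp_hasDerivWithinAt t (hu' t ht)).clm_apply (hw' t ht)
    have h2 := h1.liminf_right_slope_norm_le hr
    have h3 : ∀ᶠ z in 𝓝[>] t, a z = ‖A (l t) (u z) (w z)‖ := by
      have h4 : 𝓝[>] t ≤ 𝓝[Icc 0 T] t := by
        refine le_trans (nhdsWithin_mono t Ioi_subset_Ici_self) ?_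
        exact nhdsWithin_le_of_mem (Icc_mem_nhdsGE_of_mem ht)
      exact h4 (hloc t htI _ (hlO t ht))
    refine (h2.and_eventually h3).mono fun z hz => ?_
    rw [hz.2, haeq t htI _ (hlO t ht)]
    exact hz.1
  have hbound : ∀ t ∈ Ico 0 T,
      ‖fderiv ℝ (A (l t)) (u t) (u' t) (w t) + A (l t) (u t) (w' t)‖ ≤ κ * a t + ε := by
    intro t ht
    rw [haeq t (Ico_subset_Icc_self ht) _ (hlO t ht)]
    exact hlb t ht
  have h0 : (0 : ℝ) ∈ Icc 0 T := ⟨le_rfl, hT⟩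
  have hTm : T ∈ Icc 0 T := ⟨hT, le_rfl⟩
  have hfin := le_gronwallBound_of_liminf_deriv_right_le hcont hderiv le_rfl hbound T hTm
  rw [haeq T hTm j hj, haeq 0 h0 i hi, sub_zero] at hfin
  refine hfin.trans ((gronwallBound_le_exp hκ hε).trans ?_)
  have h5 : ε * T ≤ ε := mul_le_of_le_one_right hε hT1
  have h6 : κ * T ≤ κ := mul_le_of_le_one_right hκ hT1
  gcongr

/-- The main estimate: along a lift `u₀`, the transverse part `A_{u₀}(u₁ - u₀)` of the difference
to a nearby lift `u₁` grows at most by the factor `e^{MR}`, apart from the contribution of `dA`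
restricted to `E` and an error of higher order. -/
theorem transport_estimate (hc : IsCompatibleCover U Y E O A)
    (hE : ∀ p ∈ U, IsCompl (E p) Y) {K : Set (Euc d)} {Kc : Fin s → Set (Euc d)} (hKU : K ⊆ U)
    (hKc : ∀ i, IsCompact (Kc i)) (hKO : ∀ i, Kc i ⊆ O i) (hKK : K ⊆ ⋃ i, Kc i)
    {L : NNReal} (hL : LipschitzOnWith L (fun q => projAlong Y (E q)) K)
    {C D M ρ : ℝ} (hC0 : 0 ≤ C) (hD : 0 ≤ D) (hM : 0 ≤ M) (hρ : 0 ≤ ρ)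
    (hC : ∀ q ∈ K, ‖projAlong Y (E q)‖ ≤ C)
    (hdA : ∀ i, ∀ q ∈ Kc i, ∀ v ∈ E q, ∀ w, ‖dForm (A i) q v w‖ ≤
      ‖v‖ * (D * ‖projAlong Y (E q) w‖ + M * ‖A i q w‖))
    {η : ℝ} (hη : 0 < η) :
    ∃ δ > 0, ∀ T ξ₀ ξ₁ u₀ u₁ H, 0 ≤ T → T ≤ 1 → ‖ξ₀‖ ≤ ρ → ‖ξ₁‖ ≤ ρ →
      IsLift Y E K ξ₀ T u₀ → IsLift Y E K ξ₁ T u₁ → ‖u₁ 0 - u₀ 0‖ ≤ δ → ‖ξ₁ - ξ₀‖ ≤ δ →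
      (∀ t ∈ Icc 0 T, ‖projAlong Y (E (u₀ t)) (u₁ t - u₀ t)‖ ≤ H) →
      ∀ i j, u₀ 0 ∈ O i → u₀ T ∈ O j →
      ‖A j (u₀ T) (u₁ T - u₀ T)‖ ≤ (‖A i (u₀ 0) (u₁ 0 - u₀ 0)‖ +
        (D * (C * ρ) * H + η * (‖u₁ 0 - u₀ 0‖ + ‖ξ₁ - ξ₀‖))) * Real.exp (M * (C * ρ)) := by
  set B := (1 + C) * Real.exp (L * ρ) with hB
  have hB0 : 0 ≤ B := by positivity
  have hdiff : ∀ i, ∀ q ∈ O i, DifferentiableAt ℝ (A i) q := fun i q hq =>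
    ((hc.2.2.1 i).1.contDiffAt ((hc.1 i).mem_nhds hq)).differentiableAt one_ne_zero
  -- a bound for the derivatives of all frames on the compact pieces
  obtain ⟨CA, hCA⟩ : ∃ CA : ℝ, ∀ i, ∀ q ∈ Kc i, ‖fderiv ℝ (A i) q‖ ≤ CA := by
    have h1 : ∀ i, ∃ c : ℝ, ∀ q ∈ Kc i, ‖fderiv ℝ (A i) q‖ ≤ c := fun i =>
      (hKc i).exists_bound_of_continuousOn
        (((hc.2.2.1 i).1.continuousOn_fderiv_of_isOpen (hc.1 i) le_rfl).mono (hKO i))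
    choose c hcb using h1
    obtain ⟨CA, hCA⟩ := Finite.exists_le c
    exact ⟨CA, fun i q hq => (hcb i q hq).trans (hCA i)⟩
  -- the constants below make both second-order terms at most `η / 2` times the initial distance
  set η' := η / (2 * (B * (C * ρ) + 1)) with hη'
  have hη'0 : 0 < η' := by positivity
  obtain ⟨δ', hδ'0, hδ'⟩ : ∃ δ' > 0, ∀ i, ∀ q ∈ Kc i, ∀ p, dist p q < δ' →
      p ∈ O i ∧ ‖A i p - A i q - fderiv ℝ (A i) q (p - q)‖ ≤ η' * ‖p - q‖ := by
    have h1 : ∀ i, ∀ᶠ δ' in 𝓝[>] (0 : ℝ), ∀ q ∈ Kc i, ∀ p, dist p q < δ' →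
        p ∈ O i ∧ ‖A i p - A i q - fderiv ℝ (A i) q (p - q)‖ ≤ η' * ‖p - q‖ := by
      intro i
      obtain ⟨δ, hδ, h⟩ := exists_uniform_taylor (hc.1 i) (hKc i) (hKO i) (hc.2.2.1 i).1 hη'0
      filter_upwards [Ioc_mem_nhdsGT hδ] with δ' hδ' q hq p hp
      exact h q hq p (hp.trans_le hδ'.2)
    obtain ⟨δ', h⟩ := ((eventually_all.2 h1).and self_mem_nhdsWithin).exists
    exact ⟨δ', h.2, h.1⟩
  set Q := |CA| * B * (L * ρ * B + C) with hQ
  have hQ0 : 0 ≤ Q := by positivity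
  refine ⟨min (η / (4 * (Q + 1))) (δ' / (2 * B + 1)), by positivity, ?_⟩
  intro T ξ₀ ξ₁ u₀ u₁ H hT0 hT1 hξ₀ hξ₁ hu₀ hu₁ hw0 hξ hH i j hi hj
  have hH0 : 0 ≤ H := (norm_nonneg _).trans (hH 0 ⟨le_rfl, hT0⟩)
  set σ := ‖u₁ 0 - u₀ 0‖ + ‖ξ₁ - ξ₀‖ with hσ
  have hσ0 : 0 ≤ σ := by positivity
  have hσ1 : σ ≤ 2 * (η / (4 * (Q + 1))) := by
    have := hw0.trans (min_le_left _ _); have := hξ.trans (min_le_left _ _); linarith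
  have hσ2 : σ ≤ 2 * (δ' / (2 * B + 1)) := by
    have := hw0.trans (min_le_right _ _); have := hξ.trans (min_le_right _ _); linarith
  have hQσ : Q * σ ≤ η / 2 := by
    calc Q * σ ≤ (Q + 1) * (2 * (η / (4 * (Q + 1)))) := by gcongr; linarith
      _ = η / 2 := by field_simp; norm_num
  have hBσ : B * σ < δ' := by
    calc B * σ ≤ B * (2 * (δ' / (2 * B + 1))) := by gcongr
      _ = δ' * (2 * B / (2 * B + 1)) := by ring
      _ < δ' * 1 := by
        gcongr
        rw [div_lt_one (by positivity)]; linarith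
      _ = δ' := mul_one _
  have hη'B : η' * B * (C * ρ) ≤ η / 2 := by
    rw [hη', div_mul_eq_mul_div, div_mul_eq_mul_div, div_le_iff₀ (by positivity)]
    nlinarith
  -- the crude estimate; its constant depends on the Lipschitz constant of the bundle and only
  -- serves to make the second-order terms negligible
  have hw : ∀ t ∈ Icc 0 T, ‖u₁ t - u₀ t‖ ≤ B * σ := by
    intro t ht
    refine (hu₀.norm_sub_le hu₁ hT1 hL hC hξ₀ ht).trans ?_
    have : ‖u₁ 0 - u₀ 0‖ + C * ‖ξ₁ - ξ₀‖ ≤ (1 + C) * σ := by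
      rw [hσ]; nlinarith [norm_nonneg (u₁ 0 - u₀ 0), norm_nonneg (ξ₁ - ξ₀)]
    calc _ ≤ (1 + C) * σ * Real.exp (L * ρ) := by gcongr
      _ = B * σ := by rw [hB]; ring
  have hvb : ∀ q ∈ K, ∀ ξ : Euc d, ‖ξ‖ ≤ ρ → ‖projAlong Y (E q) ξ‖ ≤ C * ρ := fun q hq ξ hξ =>
    (ContinuousLinearMap.le_of_opNorm_le _ (hC q hq) ξ).trans (by gcongr)
  refine gronwall_compatible hc hE hT0 hT1 (by positivity) (by positivity)
    (w := fun t => u₁ t - u₀ t) hu₀.continuousOn (hu₁.continuousOn.sub hu₀.continuousOn)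
    (fun t ht => hKU (hu₀ t ht).1) (fun t ht => hu₀.hasDerivWithinAt_Ici ht)
    (fun t ht => (hu₁.hasDerivWithinAt_Ici ht).sub (hu₀.hasDerivWithinAt_Ici ht)) ?_ hi hj
  intro t ht
  have htI := Ico_subset_Icc_self ht
  have hq := (hu₀ t htI).1
  have hp := (hu₁ t htI).1
  obtain ⟨l, hl⟩ := mem_iUnion.1 (hKK hq)
  have hwt := hw t htI
  obtain ⟨hpl, htay⟩ := hδ' l _ hl (u₁ t) (by rw [dist_eq_norm]; exact hwt.trans_lt hBσ)
  refine ⟨l, hKO l hl, ?_⟩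
  have hv0 := hvb _ hq ξ₀ hξ₀
  have hv1 := hvb _ hp ξ₁ hξ₁
  have hvE := projAlong_mem (hE _ (hKU hq)) ξ₀
  refine (norm_deriv_apply_sub_le (hdiff l _ (hKO l hl))
    (apply_projAlong (hE _ (hKU hq)) ((hc.2.2.1 l).2 _ (hKO l hl)).2 ξ₀)
    (apply_projAlong (hE _ (hKU hp)) ((hc.2.2.1 l).2 _ hpl).2 ξ₁)
    htay (hdA l _ hl _ hvE _)).trans ?_
  have hdv := norm_projAlong_sub_le (ξ₁ := ξ₁) hL hC hξ₀ hp hq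
  have hdv' : ‖projAlong Y (E (u₁ t)) ξ₁ - projAlong Y (E (u₀ t)) ξ₀‖ ≤ (L * ρ * B + C) * σ := by
    refine hdv.trans ?_
    have h1 : ‖ξ₁ - ξ₀‖ ≤ σ := by rw [hσ]; linarith [norm_nonneg (u₁ 0 - u₀ 0)]
    calc _ ≤ L * ρ * (B * σ) + C * σ := by gcongr
      _ = _ := by ring
  have hm : ‖projAlong Y (E (u₀ t)) ξ₀‖ * (D * ‖projAlong Y (E (u₀ t)) (u₁ t - u₀ t)‖ +
      M * ‖A l (u₀ t) (u₁ t - u₀ t)‖) ≤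
      C * ρ * (D * H + M * ‖A l (u₀ t) (u₁ t - u₀ t)‖) := by
    gcongr
    exact hH t htI
  have he1 : η' * ‖u₁ t - u₀ t‖ * ‖projAlong Y (E (u₁ t)) ξ₁‖ ≤ η / 2 * σ := by
    calc _ ≤ η' * (B * σ) * (C * ρ) := by gcongr
      _ = η' * B * (C * ρ) * σ := by ring
      _ ≤ _ := by gcongr
  have he2 : ‖fderiv ℝ (A l) (u₀ t)‖ * ‖u₁ t - u₀ t‖ *
      ‖projAlong Y (E (u₁ t)) ξ₁ - projAlong Y (E (u₀ t)) ξ₀‖ ≤ η / 2 * σ := by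
    calc _ ≤ |CA| * (B * σ) * ((L * ρ * B + C) * σ) := by
          gcongr
          exact (hCA l _ hl).trans (le_abs_self _)
      _ = Q * σ * σ := by rw [hQ]; ring
      _ ≤ _ := by gcongr
  calc _ ≤ C * ρ * (D * H + M * ‖A l (u₀ t) (u₁ t - u₀ t)‖) + (η / 2 * σ + η / 2 * σ) :=
        add_le_add hm (add_le_add he1 he2)
    _ = _ := by ring

end Transport

/-! ### Real bounds extracted from the suprema -/

section Bounds

variable {d n s : ℕ} {U : Set (Euc d)} {Y : Submodule ℝ (Euc d)}
  {E : Euc d → Submodule ℝ (Euc d)} {O : Fin s → Set (Euc d)} {A : Fin s → FormTuple d n}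

theorem expENN_top {ε : ℝ} (hε : 0 < ε) : expENN ε ⊤ = ⊤ := by
  have h : ENNReal.ofReal ε * ⊤ = ⊤ := ENNReal.mul_top (by simpa using hε)
  simp [expENN, h]

theorem expENN_ne_zero (ε : ℝ) (M : ℝ≥0∞) : expENN ε M ≠ 0 := by
  have h1 : (1 : ℝ≥0∞) ≤ expENN ε M := by
    rw [expENN, ← EReal.exp_zero]
    exact EReal.exp_monotone (by positivity)
  exact (lt_of_lt_of_le zero_lt_one h1).ne'

theorem expENN_ofReal {ε M : ℝ} (hε : 0 ≤ ε) :
    expENN ε (ENNReal.ofReal M) = ENNReal.ofReal (Real.exp (ε * max M 0)) := by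
  have h : ((ENNReal.ofReal ε * ENNReal.ofReal M : ℝ≥0∞) : EReal) =
      ((ε * max M 0 : ℝ) : EReal) := by
    rw [← ENNReal.ofReal_mul hε, EReal.coe_ennreal_ofReal, mul_max_of_nonneg _ _ hε, mul_zero]
  rw [expENN, h, EReal.exp_coe]

theorem norm_le_of_enorm_le_ofReal {V : Type*} [SeminormedAddCommGroup V] {v : V} {c : ℝ}
    (hc : 0 ≤ c) (h : ‖v‖ₑ ≤ ENNReal.ofReal c) : ‖v‖ ≤ c := by
  rw [← ofReal_norm] at h
  exact (ENNReal.ofReal_le_ofReal_iff hc).1 h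

theorem le_supRestrict {O : Set (Euc d)} {F : Euc d → Submodule ℝ (Euc d)} {A : FormTuple d n}
    {p u : Euc d} (hp : p ∈ O) (hu : u ∈ F p) (h1 : ‖u‖ = 1) :
    ‖A p u‖ₑ ≤ supRestrict O F A :=
  (le_iSup_of_le p <| le_iSup_of_le hp <| le_iSup_of_le u <| le_iSup_of_le hu <|
    le_iSup_of_le h1 le_rfl)

theorem le_supDRestrict {O : Set (Euc d)} {F : Euc d → Submodule ℝ (Euc d)} {A : FormTuple d n}
    {p u v : Euc d} (hp : p ∈ O) (hu : u ∈ F p) (hv : v ∈ F p) (h1 : ‖u‖ = 1) (h2 : ‖v‖ = 1) :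
    ‖dForm A p u v‖ₑ ≤ supDRestrict O F A :=
  (le_iSup_of_le p <| le_iSup_of_le hp <| le_iSup_of_le u <| le_iSup_of_le hu <|
    le_iSup_of_le v <| le_iSup_of_le hv <| le_iSup_of_le h1 <| le_iSup_of_le h2 le_rfl)

theorem le_supInv {O : Set (Euc d)} {A : FormTuple d n} {p : Euc d} (hp : p ∈ O) :
    ‖transInv Y (A p)‖ₑ ≤ supInv O Y A :=
  le_iSup_of_le p <| le_iSup_of_le hp le_rfl

theorem le_supMixed {O : Set (Euc d)} {F : Euc d → Submodule ℝ (Euc d)} {A : FormTuple d n}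
    {p v : Euc d} {w : Euc n} (hp : p ∈ O) (hv : v ∈ F p) (h1 : ‖v‖ = 1) (h2 : ‖w‖ = 1) :
    ‖dForm A p (transInv Y (A p) w) v‖ₑ ≤ supMixed O Y F A :=
  (le_iSup_of_le p <| le_iSup_of_le hp <| le_iSup_of_le v <| le_iSup_of_le hv <|
    le_iSup_of_le w <| le_iSup_of_le h1 <| le_iSup_of_le h2 le_rfl)

/-- A linear map is bounded on a subspace by its bound on unit vectors. -/
theorem norm_apply_le_of_unit {V G : Type*} [NormedAddCommGroup V] [NormedSpace ℝ V]
    [NormedAddCommGroup G] [NormedSpace ℝ G] (f : V →ₗ[ℝ] G) (F : Submodule ℝ V) {c : ℝ}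
    (h : ∀ u ∈ F, ‖u‖ = 1 → ‖f u‖ ≤ c) {u : V} (hu : u ∈ F) : ‖f u‖ ≤ c * ‖u‖ := by
  by_cases h0 : u = 0
  · simp [h0]
  have hn : 0 < ‖u‖ := norm_pos_iff.2 h0
  have h1 := h (‖u‖⁻¹ • u) (F.smul_mem _ hu) (by rw [norm_smul, norm_inv, norm_norm,
    inv_mul_cancel₀ hn.ne'])
  rw [map_smul, norm_smul, norm_inv, norm_norm, inv_mul_le_iff₀ hn] at h1
  linarith

variable {A₁ : FormTuple d n} {p : Euc d}

/-- `dA_p` as a bilinear map. -/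
noncomputable def dFormBilin (A : FormTuple d n) (p : Euc d) : Euc d →ₗ[ℝ] Euc d →ₗ[ℝ] Euc n :=
  LinearMap.mk₂ ℝ (fun u v => fderiv ℝ A p u v - fderiv ℝ A p v u)
    (by intros; simp; abel) (by intros; simp [smul_sub]) (by intros; simp; abel)
    (by intros; simp [smul_sub])

theorem dFormBilin_apply (hA : DifferentiableAt ℝ A₁ p) (u v : Euc d) :
    dFormBilin A₁ p u v = dForm A₁ p u v := by
  rw [dForm_eq _ _ _ _ hA]; rfl

theorem dForm_add_right (hA : DifferentiableAt ℝ A₁ p) (u v w : Euc d) :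
    dForm A₁ p u (v + w) = dForm A₁ p u v + dForm A₁ p u w := by
  simp only [← dFormBilin_apply hA, map_add]

theorem dForm_swap (hA : DifferentiableAt ℝ A₁ p) (u v : Euc d) :
    dForm A₁ p u v = - dForm A₁ p v u := by
  rw [dForm_eq _ _ _ _ hA, dForm_eq _ _ _ _ hA]; abel

theorem norm_dForm_le (hA : DifferentiableAt ℝ A₁ p) (u v : Euc d) :
    ‖dForm A₁ p u v‖ ≤ 2 * ‖fderiv ℝ A₁ p‖ * ‖u‖ * ‖v‖ := by
  rw [dForm_eq _ _ _ _ hA]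
  have h1 := ContinuousLinearMap.le_opNorm₂ (fderiv ℝ A₁ p) u v
  have h2 := ContinuousLinearMap.le_opNorm₂ (fderiv ℝ A₁ p) v u
  refine (norm_sub_le _ _).trans ?_
  linarith

theorem norm_dForm_le_of_supDRestrict {O : Set (Euc d)} {F : Euc d → Submodule ℝ (Euc d)}
    (hA : DifferentiableAt ℝ A₁ p) (hp : p ∈ O) {D : ℝ} (hD : 0 ≤ D)
    (h : supDRestrict O F A₁ ≤ ENNReal.ofReal D) {u v : Euc d} (hu : u ∈ F p) (hv : v ∈ F p) :
    ‖dForm A₁ p u v‖ ≤ D * ‖u‖ * ‖v‖ := by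
  rw [← dFormBilin_apply hA]
  refine norm_apply_le_of_unit (dFormBilin A₁ p u) (F p) (fun v hv h2 => ?_) hv
  have := norm_apply_le_of_unit ((dFormBilin A₁ p).flip v) (F p) (c := D) (fun u hu h1 => ?_) hu
  · simpa using this
  · rw [LinearMap.flip_apply, dFormBilin_apply hA]
    exact norm_le_of_enorm_le_ofReal hD ((le_supDRestrict hp hu hv h1 h2).trans h)

theorem norm_dForm_le_of_supMixed {O : Set (Euc d)} {F : Euc d → Submodule ℝ (Euc d)}
    (hA : DifferentiableAt ℝ A₁ p) (hp : p ∈ O) {M : ℝ} (hM : 0 ≤ M)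
    (h : supMixed O Y F A₁ ≤ ENNReal.ofReal M) {v : Euc d} (hv : v ∈ F p) (w : Euc n) :
    ‖dForm A₁ p (transInv Y (A₁ p) w) v‖ ≤ M * ‖w‖ * ‖v‖ := by
  rw [← dFormBilin_apply hA]
  refine norm_apply_le_of_unit (dFormBilin A₁ p (transInv Y (A₁ p) w)) (F p)
    (fun v hv h2 => ?_) hv
  have := norm_apply_le_of_unit (((dFormBilin A₁ p).flip v) ∘ₗ (transInv Y (A₁ p)).toLinearMap) ⊤
    (c := M) (fun w _ h1 => ?_) (Submodule.mem_top (x := w))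
  · simpa using this
  · simp only [LinearMap.comp_apply, LinearMap.flip_apply]
    rw [dFormBilin_apply hA]
    exact norm_le_of_enorm_le_ofReal hM ((le_supMixed hp hv h2 h1).trans h)

theorem IsCompatibleCover.differentiableAt (hc : IsCompatibleCover U Y E O A) {i : Fin s}
    {q : Euc d} (hq : q ∈ O i) : DifferentiableAt ℝ (A i) q :=
  ((hc.2.2.1 i).1.contDiffAt ((hc.1 i).mem_nhds hq)).differentiableAt one_ne_zero

theorem IsCompatibleCover.exists_compact_cover (hc : IsCompatibleCover U Y E O A)
    {K : Set (Euc d)} (hK : IsCompact K) (hKU : K ⊆ U) :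
    ∃ Kc : Fin s → Set (Euc d), (∀ i, IsCompact (Kc i)) ∧ (∀ i, Kc i ⊆ O i) ∧ K ⊆ ⋃ i, Kc i := by
  obtain ⟨Kc, h1, h2, h3⟩ := hK.finite_compact_cover Finset.univ O (fun i _ => hc.1 i)
    (by simpa [hc.2.1] using hKU)
  exact ⟨Kc, h1, h2, by simpa using h3.le⟩

/-- On compact sets, all the quantities that enter the conditions are finite. -/
theorem exists_local_bounds (hc : IsCompatibleCover U Y E O A) (hE : ∀ p ∈ U, IsCompl (E p) Y)
    {Kc : Fin s → Set (Euc d)} (hKc : ∀ i, IsCompact (Kc i)) (hKO : ∀ i, Kc i ⊆ O i) :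
    ∃ c : ℝ, 0 ≤ c ∧ ∀ i, ∀ q ∈ Kc i, ‖transInv Y (A i q)‖ ≤ c ∧
      (∀ u v, ‖dForm (A i) q u v‖ ≤ c * ‖u‖ * ‖v‖) ∧
      ∀ v w, ‖dForm (A i) q (transInv Y (A i q) w) v‖ ≤ c * ‖w‖ * ‖v‖ := by
  have h1 : ∀ i, ∃ c : ℝ, ∀ q ∈ Kc i, ‖transInv Y (A i q)‖ ≤ c := fun i =>
    (hKc i).exists_bound_of_continuousOn (((hc.2.2.1 i).contDiffOn_transInv
      fun p hp => hE p (hc.subset i hp)).continuousOn.mono (hKO i))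
  have h2 : ∀ i, ∃ c : ℝ, ∀ q ∈ Kc i, ‖fderiv ℝ (A i) q‖ ≤ c := fun i =>
    (hKc i).exists_bound_of_continuousOn
      (((hc.2.2.1 i).1.continuousOn_fderiv_of_isOpen (hc.1 i) le_rfl).mono (hKO i))
  choose c₁ h₁ using h1
  choose c₂ h₂ using h2
  obtain ⟨b₁, hb₁⟩ := Finite.exists_le c₁
  obtain ⟨b₂, hb₂⟩ := Finite.exists_le c₂
  have key : ∀ i, ∀ q ∈ Kc i, ∀ u v, ‖dForm (A i) q u v‖ ≤ 2 * |b₂| * ‖u‖ * ‖v‖ := by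
    intro i q hq u v
    refine (norm_dForm_le (hc.differentiableAt (hKO i hq)) u v).trans ?_
    gcongr
    exact ((h₂ i q hq).trans (hb₂ i)).trans (le_abs_self _)
  have hI : ∀ i, ∀ q ∈ Kc i, ‖transInv Y (A i q)‖ ≤ |b₁| := fun i q hq =>
    ((h₁ i q hq).trans (hb₁ i)).trans (le_abs_self _)
  refine ⟨|b₁| + 2 * |b₂| + 2 * |b₂| * |b₁|, by positivity, fun i q hq => ⟨?_, ?_, ?_⟩⟩
  · refine (hI i q hq).trans ?_
    have : 0 ≤ 2 * |b₂| * |b₁| := by positivity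
    linarith [abs_nonneg b₂]
  · intro u v
    refine (key i q hq u v).trans ?_
    gcongr
    have : 0 ≤ 2 * |b₂| * |b₁| := by positivity
    linarith [abs_nonneg b₁]
  · intro v w
    refine (key i q hq _ v).trans (mul_le_mul_of_nonneg_right ?_ (norm_nonneg _))
    calc 2 * |b₂| * ‖transInv Y (A i q) w‖ ≤ 2 * |b₂| * (|b₁| * ‖w‖) := by
          gcongr
          exact ContinuousLinearMap.le_of_opNorm_le _ (hI i q hq) _
      _ = 2 * |b₂| * |b₁| * ‖w‖ := by ring
      _ ≤ _ := by gcongr; linarith [abs_nonneg b₁, abs_nonneg b₂]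

/-- Real constants with a small product `D I e^{εM}` that bound `X`, `A⁻¹` and the mixed part of
`dA` over a compact set.  When the supremum of `X` vanishes, those of the other two factors may be
infinite; the bounds for them then come from compactness. -/
theorem exists_real_bounds (hc : IsCompatibleCover U Y E O A) (hE : ∀ p ∈ U, IsCompl (E p) Y)
    {Kc : Fin s → Set (Euc d)} (hKc : ∀ i, IsCompact (Kc i)) (hKO : ∀ i, Kc i ⊆ O i)
    (hne : U.Nonempty) {X : Fin s → ℝ≥0∞} {ε δ : ℝ} (hε : 0 < ε) (hδ : 0 ≤ δ)
    (hX : ⨆ (i : Fin s) (j : Fin s) (l : Fin s),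
      X i * supInv (O j) Y (A j) * expENN ε (supMixed (O l) Y E (A l)) ≤ ENNReal.ofReal δ) :
    ∃ D I M : ℝ, 0 ≤ D ∧ 0 ≤ I ∧ 0 ≤ M ∧ D * I * Real.exp (M * ε) ≤ δ ∧
      (∀ i, X i ≤ ENNReal.ofReal D) ∧ (∀ i, ∀ q ∈ Kc i, ‖transInv Y (A i q)‖ ≤ I) ∧
      ∀ i, ∀ q ∈ Kc i, ∀ v ∈ E q, ∀ w,
        ‖dForm (A i) q (transInv Y (A i q) w) v‖ ≤ M * ‖w‖ * ‖v‖ := by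
  by_cases hX0 : ∀ i, X i = 0
  -- `0 * ∞ = 0`: here the hypothesis says nothing about the other two suprema
  · obtain ⟨c, hc0, hcb⟩ := exists_local_bounds hc hE hKc hKO
    exact ⟨0, c, c, le_rfl, hc0, hc0, by simpa using hδ, fun i => by simp [hX0 i],
      fun i q hq => (hcb i q hq).1, fun i q hq v _ w => (hcb i q hq).2.2 v w⟩
  push Not at hX0
  obtain ⟨i₀, hi₀⟩ := hX0
  have : Nonempty (Fin s) := ⟨i₀⟩
  obtain ⟨i₁, hi₁⟩ := exists_eq_ciSup_of_finite (f := X)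
  obtain ⟨j₁, hj₁⟩ := exists_eq_ciSup_of_finite (f := fun j => supInv (O j) Y (A j))
  obtain ⟨l₁, hl₁⟩ := exists_eq_ciSup_of_finite (f := fun l => supMixed (O l) Y E (A l))
  have hprod : X i₁ * supInv (O j₁) Y (A j₁) * expENN ε (supMixed (O l₁) Y E (A l₁)) ≤
      ENNReal.ofReal δ := by
    refine le_trans (le_iSup_of_le i₁ (le_iSup_of_le j₁ ?_)) hX
    exact le_iSup (fun l => X i₁ * supInv (O j₁) Y (A j₁) *
      expENN ε (supMixed (O l) Y E (A l))) l₁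
  have hX1 : ∀ i, X i ≤ X i₁ := fun i => hi₁ ▸ le_iSup X i
  have hI1 : ∀ j, supInv (O j) Y (A j) ≤ supInv (O j₁) Y (A j₁) := fun j =>
    hj₁ ▸ le_iSup (fun j => supInv (O j) Y (A j)) j
  have hM1 : ∀ l, supMixed (O l) Y E (A l) ≤ supMixed (O l₁) Y E (A l₁) := fun l =>
    hl₁ ▸ le_iSup (fun l => supMixed (O l) Y E (A l)) l
  have hXne : X i₁ ≠ 0 := fun h => hi₀ (le_antisymm (h ▸ hX1 i₀) zero_le)
  -- compatibility of a frame with itself excludes `A⁻¹ = 0`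
  have hIne : supInv (O j₁) Y (A j₁) ≠ 0 := by
    obtain ⟨q, hq⟩ := hne
    obtain ⟨j, hj⟩ := hc.exists_mem hq
    intro h
    have h1 : ‖transInv Y (A j q)‖ₑ = 0 :=
      le_antisymm (((le_supInv hj).trans (hI1 j)).trans h.le) zero_le
    have h2 := hc.2.2.2 j j q ⟨hj, hj⟩
    have h3 : transInv Y (A j q) = 0 := by
      rw [← ofReal_norm, ENNReal.ofReal_eq_zero] at h1
      exact norm_le_zero_iff.1 h1
    rw [h3] at h2
    simp at h2
  have hEne := expENN_ne_zero ε (supMixed (O l₁) Y E (A l₁))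
  have hlt := hprod.trans_lt ENNReal.ofReal_lt_top
  have hXI : X i₁ * supInv (O j₁) Y (A j₁) ≠ ⊤ := fun h => by
    rw [h, ENNReal.top_mul hEne] at hlt; exact lt_irrefl _ hlt
  have hEt : expENN ε (supMixed (O l₁) Y E (A l₁)) ≠ ⊤ := fun h => by
    rw [h, ENNReal.mul_top (mul_ne_zero hXne hIne)] at hlt; exact lt_irrefl _ hlt
  have hXt : X i₁ ≠ ⊤ := fun h => hXI (by rw [h, ENNReal.top_mul hIne])
  have hIt : supInv (O j₁) Y (A j₁) ≠ ⊤ := fun h => hXI (by rw [h, ENNReal.mul_top hXne])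
  have hMt : supMixed (O l₁) Y E (A l₁) ≠ ⊤ := fun h => hEt (by rw [h, expENN_top hε])
  have hXr := ENNReal.ofReal_toReal hXt
  have hIr := ENNReal.ofReal_toReal hIt
  have hMr := ENNReal.ofReal_toReal hMt
  refine ⟨(X i₁).toReal, (supInv (O j₁) Y (A j₁)).toReal, (supMixed (O l₁) Y E (A l₁)).toReal,
    ENNReal.toReal_nonneg, ENNReal.toReal_nonneg, ENNReal.toReal_nonneg, ?_,
    fun i => hXr.symm ▸ hX1 i, fun i q hq => ?_, fun i q hq v hv w => ?_⟩
  · rw [← hXr, ← hIr, ← hMr, expENN_ofReal hε.le, max_eq_left ENNReal.toReal_nonneg,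
      ← ENNReal.ofReal_mul ENNReal.toReal_nonneg, ← ENNReal.ofReal_mul (by positivity),
      ENNReal.ofReal_le_ofReal_iff hδ] at hprod
    rwa [mul_comm _ ε]
  · refine norm_le_of_enorm_le_ofReal ENNReal.toReal_nonneg ?_
    rw [hIr]
    exact (le_supInv (hKO i hq)).trans (hI1 i)
  · exact norm_dForm_le_of_supMixed (hc.differentiableAt (hKO i hq)) (hKO i hq)
      ENNReal.toReal_nonneg (by rw [hMr]; exact hM1 i) hv w

/-- Splitting `w` into its components in `E` and in `Y`. -/
theorem norm_dForm_le_split (hc : IsCompatibleCover U Y E O A) (hE : ∀ p ∈ U, IsCompl (E p) Y)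
    {i : Fin s} {q : Euc d} (hq : q ∈ O i) {D M : ℝ}
    (hD : ∀ u ∈ E q, ∀ v ∈ E q, ‖dForm (A i) q u v‖ ≤ D * ‖u‖ * ‖v‖)
    (hM : ∀ v ∈ E q, ∀ w, ‖dForm (A i) q (transInv Y (A i q) w) v‖ ≤ M * ‖w‖ * ‖v‖)
    {v : Euc d} (hv : v ∈ E q) (w : Euc d) :
    ‖dForm (A i) q v w‖ ≤ ‖v‖ * (D * ‖projAlong Y (E q) w‖ + M * ‖A i q w‖) := by
  have hd := hc.differentiableAt hq
  have hEq := hE q (hc.subset i hq)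
  obtain ⟨hs, hk⟩ := (hc.2.2.1 i).2 q hq
  have h1 : dForm (A i) q v w = dForm (A i) q v (projAlong Y (E q) w) +
      dForm (A i) q v (transInv Y (A i q) (A i q w)) := by
    rw [← dForm_add_right hd, transInv_apply hEq hs hk]
    congr 1; abel
  rw [h1]
  have h2 := hD v hv _ (projAlong_mem hEq w)
  have h3 := hM v hv (A i q w)
  rw [dForm_swap hd, norm_neg] at h3
  calc _ ≤ D * ‖v‖ * ‖projAlong Y (E q) w‖ + M * ‖A i q w‖ * ‖v‖ :=
        (norm_add_le _ _).trans (add_le_add h2 h3)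
    _ = _ := by ring

end Bounds

/-! ### Continuity of the projections and convergence in angle -/

section Angle

variable {d m : ℕ} {U : Set (Euc d)} {Y : Submodule ℝ (Euc d)}
  {E : Euc d → Submodule ℝ (Euc d)}

/-- The projection onto a continuous subbundle along a transverse subspace is continuous. -/
theorem IsSubbundle.continuousOn_projAlong (hE : IsSubbundle 0 m U E)
    (hY : ∀ p ∈ U, IsCompl (E p) Y) : ContinuousOn (fun q => projAlong Y (E q)) U := by
  intro p hp
  -- with `Φ q (a, y) = ∑ aᵢ Xᵢ(q) + y`, the projection is `v ↦ ∑ aᵢ Xᵢ(q)` for `(a, y) = (Φ q)⁻¹ v`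
  obtain ⟨W, X, hW, hpW, hWU, hX, hspan⟩ := hE p hp
  let S : Euc d → (Fin m → ℝ) →L[ℝ] Euc d := fun q =>
    ∑ i, (ContinuousLinearMap.proj (R := ℝ) (φ := fun _ : Fin m => ℝ) i).smulRight (X i q)
  have hSapp : ∀ q a, S q a = ∑ i, a i • X i q := fun q a => by
    simp [S]
  have hScont : ContinuousOn S W := by
    refine continuousOn_finsetSum _ fun i _ => ?_
    exact (ContinuousLinearMap.smulRightL ℝ (Fin m → ℝ) (Euc d)
      (ContinuousLinearMap.proj i)).continuous.comp_continuousOn (hX i).continuousOn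
  let Φ : Euc d → ((Fin m → ℝ) × Y) →L[ℝ] Euc d := fun q =>
    S q ∘L ContinuousLinearMap.fst ℝ (Fin m → ℝ) Y +
      Y.subtypeL ∘L ContinuousLinearMap.snd ℝ (Fin m → ℝ) Y
  have hΦapp : ∀ q z, Φ q z = S q z.1 + z.2 := fun q z => by simp [Φ]
  have hΦcont : ContinuousOn Φ W :=
    (hScont.clm_comp continuousOn_const).add continuousOn_const
  have hSmem : ∀ q ∈ W, ∀ a, S q a ∈ E q := by
    intro q hq a
    rw [← (hspan q hq).2, hSapp]
    exact Submodule.sum_mem _ fun i _ =>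
      Submodule.smul_mem _ _ (Submodule.subset_span (mem_range_self i))
  have hinv : ∀ q ∈ W, (Φ q).IsInvertible := by
    intro q hq
    have hq' := hY q (hWU hq)
    have hinj : Function.Injective (Φ q) := by
      rw [injective_iff_map_eq_zero]
      rintro ⟨a, y⟩ h
      rw [hΦapp] at h
      have h1 : S q a = -(y : Euc d) := eq_neg_of_add_eq_zero_left h
      have h2 : S q a ∈ E q ⊓ Y := ⟨hSmem q hq a, h1 ▸ Y.neg_mem y.2⟩
      rw [hq'.inf_eq_bot, Submodule.mem_bot] at h2
      have h3 : a = 0 := by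
        rw [hSapp] at h2
        exact funext (Fintype.linearIndependent_iff.1 (hspan q hq).1 a h2)
      have h4 : (y : Euc d) = 0 := by rw [h2] at h1; exact neg_eq_zero.1 h1.symm
      exact Prod.ext h3 (Subtype.ext h4)
    have hsurj : Function.Surjective (Φ q) := by
      intro v
      have h1 : projAlong Y (E q) v ∈ Submodule.span ℝ (Set.range fun i => X i q) := by
        rw [(hspan q hq).2]; exact projAlong_mem hq' v
      obtain ⟨a, ha⟩ := (Submodule.mem_span_range_iff_exists_fun ℝ).1 h1
      refine ⟨(a, ⟨v - projAlong Y (E q) v, sub_projAlong_mem hq' v⟩), ?_⟩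
      rw [hΦapp, hSapp, ha]
      simp
    refine ⟨(LinearEquiv.ofBijective (Φ q).toLinearMap
      ⟨hinj, hsurj⟩).toContinuousLinearEquiv, ?_⟩
    ext <;> rfl
  have heq : ∀ q ∈ W, projAlong Y (E q) =
      S q ∘L ContinuousLinearMap.fst ℝ (Fin m → ℝ) Y ∘L (Φ q).inverse := by
    intro q hq
    ext1 v
    refine projAlong_eq_of_mem (hY q (hWU hq)) (hSmem q hq _) ?_
    have h1 : Φ q ((Φ q).inverse v) = v := (hinv q hq).self_apply_inverse v
    rw [hΦapp] at h1
    have h2 : S q ((Φ q).inverse v).1 - v = -(((Φ q).inverse v).2 : Euc d) := by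
      rw [sub_eq_iff_eq_add, eq_neg_add_iff_add_eq, add_comm]; exact h1
    simp only [ContinuousLinearMap.comp_apply, ContinuousLinearMap.coe_fst']
    rw [h2]
    exact Y.neg_mem (Submodule.coe_mem _)
  have h1 : ContinuousAt (fun q => (Φ q).inverse) p :=
    ContinuousAt.comp (g := ContinuousLinearMap.inverse)
      ((hinv p hpW).contDiffAt_map_inverse (n := 0)).continuousAt
      (hΦcont.continuousAt (hW.mem_nhds hpW))
  have h2 : ContinuousAt (fun q =>
      S q ∘L ContinuousLinearMap.fst ℝ (Fin m → ℝ) Y ∘L (Φ q).inverse) p :=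
    (hScont.continuousAt (hW.mem_nhds hpW)).clm_comp (continuousAt_const.clm_comp h1)
  refine (h2.congr ?_).continuousWithinAt
  filter_upwards [hW.mem_nhds hpW] with q hq
  exact (heq q hq).symm

theorem norm_sub_le_angle {V : Type*} [NormedAddCommGroup V] [InnerProductSpace ℝ V] {u v : V}
    (hu : ‖u‖ = 1) (hv : ‖v‖ = 1) : ‖u - v‖ ≤ InnerProductGeometry.angle u v := by
  have h1 := Real.one_sub_sq_div_two_le_cos (x := InnerProductGeometry.angle u v)
  rw [InnerProductGeometry.cos_angle, hu, hv] at h1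
  have h2 := norm_sub_sq_real u v
  rw [hu, hv] at h2
  refine le_of_sq_le_sq ?_ (InnerProductGeometry.angle_nonneg u v)
  linarith

theorem exists_near_unit_of_subspaceAngle_le {F G : Submodule ℝ (Euc d)} (hF : IsCompl F Y)
    (hG : IsCompl G Y) {δ : ℝ} (hδ : 0 < δ) (h : subspaceAngle F G ≤ δ) {u : Euc d} (hu : u ∈ F)
    (hu1 : ‖u‖ = 1) : ∃ v ∈ G, ‖u - v‖ ≤ 2 * δ := by
  -- `G` contains a unit vector, so that the infima in the definition of the angle are no junk
  obtain ⟨v₀, hv₀, hv₀1⟩ : ∃ v ∈ G, ‖v‖ = 1 := by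
    have h0 : projAlong Y G u ≠ 0 := by
      intro h0
      have h1 : u ∈ F ⊓ Y := ⟨hu, (projAlong_eq_zero_iff hG).1 h0⟩
      rw [hF.inf_eq_bot, Submodule.mem_bot] at h1
      rw [h1, norm_zero] at hu1
      exact zero_ne_one hu1
    refine ⟨‖projAlong Y G u‖⁻¹ • projAlong Y G u, G.smul_mem _ (projAlong_mem hG u), ?_⟩
    rw [norm_smul, norm_inv, norm_norm, inv_mul_cancel₀ (norm_ne_zero_iff.2 h0)]
  have hbelow : ∀ u : Euc d,
      BddBelow {φ : ℝ | ∃ v ∈ G, ‖v‖ = 1 ∧ φ = InnerProductGeometry.angle u v} := by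
    intro u
    refine ⟨0, ?_⟩
    rintro φ ⟨v, -, -, rfl⟩
    exact InnerProductGeometry.angle_nonneg _ _
  have habove : BddAbove {θ : ℝ | ∃ u ∈ F, ‖u‖ = 1 ∧
      θ = sInf {φ : ℝ | ∃ v ∈ G, ‖v‖ = 1 ∧ φ = InnerProductGeometry.angle u v}} := by
    refine ⟨Real.pi, ?_⟩
    rintro θ ⟨u, -, -, rfl⟩
    exact (csInf_le (hbelow u) ⟨v₀, hv₀, hv₀1, rfl⟩).trans (InnerProductGeometry.angle_le_pi _ _)
  have h1 : sInf {φ : ℝ | ∃ v ∈ G, ‖v‖ = 1 ∧ φ = InnerProductGeometry.angle u v} < 2 * δ :=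
    ((le_csSup habove ⟨u, hu, hu1, rfl⟩).trans h).trans_lt (by linarith)
  have hne : Set.Nonempty
      {φ : ℝ | ∃ v ∈ G, ‖v‖ = 1 ∧ φ = InnerProductGeometry.angle u v} :=
    ⟨_, v₀, hv₀, hv₀1, rfl⟩
  obtain ⟨φ, ⟨v, hv, hv1, rfl⟩, hφ⟩ := exists_lt_of_csInf_lt hne h1
  exact ⟨v, hv, (norm_sub_le_angle hu1 hv1).trans hφ.le⟩

/-- The angle between two complements of `Y` bounds the distance of the projections along `Y`, since
`π_G - π_F = (π_G - 1) ∘ π_F` and `π_G - 1` vanishes on `G`. -/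
theorem norm_projAlong_sub_le_of_subspaceAngle {F G : Submodule ℝ (Euc d)} (hF : IsCompl F Y)
    (hG : IsCompl G Y) {δ : ℝ} (hδ : 0 < δ) (h : subspaceAngle F G ≤ δ) :
    ‖projAlong Y G - projAlong Y F‖ ≤ (‖projAlong Y G‖ + 1) * (2 * δ) * ‖projAlong Y F‖ := by
  refine ContinuousLinearMap.opNorm_le_bound _ (by positivity) fun x => ?_
  have h1 : (projAlong Y G - projAlong Y F) x =
      (projAlong Y G - ContinuousLinearMap.id ℝ (Euc d)) (projAlong Y F x) := by
    have := projAlong_eq_of_sub_mem hG (sub_projAlong_mem hF x)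
    simp [this]
  have h2 : ∀ u ∈ F, ‖u‖ = 1 → ‖(projAlong Y G - ContinuousLinearMap.id ℝ (Euc d)) u‖ ≤
      (‖projAlong Y G‖ + 1) * (2 * δ) := by
    intro u hu hu1
    obtain ⟨v, hv, huv⟩ := exists_near_unit_of_subspaceAngle_le hF hG hδ h hu hu1
    have h3 : (projAlong Y G - ContinuousLinearMap.id ℝ (Euc d)) u =
        projAlong Y G (u - v) - (u - v) := by
      simp [projAlong_eq_self hG hv]
    rw [h3]
    calc _ ≤ ‖projAlong Y G (u - v)‖ + ‖u - v‖ := norm_sub_le _ _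
      _ ≤ ‖projAlong Y G‖ * ‖u - v‖ + ‖u - v‖ := by
          gcongr; exact ContinuousLinearMap.le_opNorm _ _
      _ = (‖projAlong Y G‖ + 1) * ‖u - v‖ := by ring
      _ ≤ _ := by gcongr
  have h4 := norm_apply_le_of_unit
    (projAlong Y G - ContinuousLinearMap.id ℝ (Euc d)).toLinearMap F h2 (projAlong_mem hF x)
  rw [h1, mul_assoc _ ‖projAlong Y F‖]
  refine h4.trans ?_
  gcongr
  exact ContinuousLinearMap.le_opNorm _ _

/-- Near each point, convergence in angle is uniform convergence of the projections along `Y`. -/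
theorem exists_ball_uniform_convergence (hU : IsOpen U) (hE : IsSubbundle 0 m U E)
    (hY : ∀ p ∈ U, IsCompl (E p) Y) {Ek : ℕ → Euc d → Submodule ℝ (Euc d)}
    (hk : ∀ k, ∀ p ∈ U, IsCompl (Ek k p) Y) (hconv : ConvergesInAngle U Ek E) {p₀ : Euc d}
    (hp₀ : p₀ ∈ U) : ∃ r > 0, ∃ C > 0, Metric.closedBall p₀ r ⊆ U ∧
      (∀ q ∈ Metric.closedBall p₀ r, ‖projAlong Y (E q)‖ ≤ C) ∧
      (∀ᶠ k in atTop, ∀ q ∈ Metric.closedBall p₀ r, ‖projAlong Y (Ek k q)‖ ≤ C) ∧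
      ∀ e > 0, ∀ᶠ k in atTop, ∀ q ∈ Metric.closedBall p₀ r,
        ‖projAlong Y (Ek k q) - projAlong Y (E q)‖ ≤ e := by
  obtain ⟨r, hr, hrU⟩ := Metric.nhds_basis_closedBall.mem_iff.1 (hU.mem_nhds hp₀)
  obtain ⟨b, hb⟩ := (isCompact_closedBall p₀ r).exists_bound_of_continuousOn
    ((hE.continuousOn_projAlong hY).mono hrU)
  set c := |b| + 1 with hc
  have hc0 : 0 < c := by positivity
  have hbc : ∀ q ∈ Metric.closedBall p₀ r, ‖projAlong Y (E q)‖ ≤ c := fun q hq =>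
    (hb q hq).trans ((le_abs_self b).trans (by linarith))
  have main : ∀ δ > 0, 2 * δ * c ≤ 1 / 2 → ∀ᶠ k in atTop, ∀ q ∈ Metric.closedBall p₀ r,
      ‖projAlong Y (Ek k q)‖ ≤ 2 * c + 1 ∧
      ‖projAlong Y (Ek k q) - projAlong Y (E q)‖ ≤ (2 * c + 2) * (2 * δ) * c := by
    intro δ hδ hδc
    filter_upwards [hconv δ hδ] with k hk' q hq
    have h1 := norm_projAlong_sub_le_of_subspaceAngle (hY q (hrU hq)) (hk k q (hrU hq)) hδ
      (hk' q (hrU hq))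
    have h2 : ‖projAlong Y (Ek k q) - projAlong Y (E q)‖ ≤
        (‖projAlong Y (Ek k q)‖ + 1) * (2 * δ * c) := by
      refine h1.trans ?_
      rw [mul_assoc]
      gcongr
      exact hbc q hq
    have h3 : ‖projAlong Y (Ek k q)‖ ≤ 2 * c + 1 := by
      have h4 : ‖projAlong Y (Ek k q)‖ ≤
          ‖projAlong Y (Ek k q) - projAlong Y (E q)‖ + ‖projAlong Y (E q)‖ :=
        norm_le_norm_sub_add _ _
      have h5 : (‖projAlong Y (Ek k q)‖ + 1) * (2 * δ * c) ≤
          (‖projAlong Y (Ek k q)‖ + 1) * (1 / 2) := by gcongr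
      linarith [hbc q hq]
    refine ⟨h3, h2.trans ?_⟩
    rw [← mul_assoc]
    have h6 : ‖projAlong Y (Ek k q)‖ + 1 ≤ 2 * c + 2 := by linarith
    gcongr
  refine ⟨r, hr, 2 * c + 1, by positivity, hrU, fun q hq => (hbc q hq).trans (by linarith), ?_, ?_⟩
  · filter_upwards [main (1 / (4 * c)) (by positivity) (by field_simp; norm_num)] with k hk q hq
    exact (hk q hq).1
  · intro e he
    filter_upwards [main (min (1 / (4 * c)) (e / ((2 * c + 2) * 2 * c))) (by positivity) (by
      calc _ ≤ 2 * (1 / (4 * c)) * c := by gcongr; exact min_le_left _ _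
        _ ≤ 1 / 2 := by field_simp; norm_num)] with k hk q hq
    refine (hk q hq).2.trans ?_
    calc _ ≤ (2 * c + 2) * (2 * (e / ((2 * c + 2) * 2 * c))) * c := by
          gcongr; exact min_le_right _ _
      _ = e := by field_simp

end Angle

/-! ### Approximate leaves and their limits -/

/-- `F` parametrizes a surface through `p₀` inside the closed ball of radius `r`, over the ball of
radius `ρ` in `ℝ^d / Y`, whose tangent spaces are `E` up to an error `c`.  The last condition
says this without derivatives: if the projection onto `E` along `Y` is `e`-close to `P` over a
segment, then the increment of `F` over that segment is given by `P` up to `c + e`. -/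
def IsApproxLeaf {d : ℕ} (Y : Submodule ℝ (Euc d)) (E : Euc d → Submodule ℝ (Euc d)) (p₀ : Euc d)
    (r ρ c : ℝ) (F : Euc d → Euc d) : Prop :=
  F 0 = p₀ ∧ (∀ ξ, ‖ξ‖ ≤ ρ → F ξ ∈ Metric.closedBall p₀ r ∧ F ξ - (p₀ + ξ) ∈ Y) ∧
  ∀ (ξ ζ : Euc d) (P : Euc d →L[ℝ] Euc d) (e : ℝ), ‖ξ‖ ≤ ρ → ‖ζ‖ ≤ ρ →
    (∀ s ∈ Icc (0 : ℝ) 1, ‖projAlong Y (E (F (ξ + s • (ζ - ξ)))) - P‖ ≤ e) →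
    ‖F ζ - F ξ - P (ζ - ξ)‖ ≤ (c + e) * ‖ζ - ξ‖

section Leaf

variable {d n s : ℕ} {U : Set (Euc d)} {Y : Submodule ℝ (Euc d)}
  {E : Euc d → Submodule ℝ (Euc d)} {O : Fin s → Set (Euc d)} {A : Fin s → FormTuple d n}

theorem norm_add_smul_sub_le {V : Type*} [SeminormedAddCommGroup V] [NormedSpace ℝ V] {ξ ζ : V}
    {ρ : ℝ} (hξ : ‖ξ‖ ≤ ρ) (hζ : ‖ζ‖ ≤ ρ) {s : ℝ} (hs : s ∈ Icc (0 : ℝ) 1) :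
    ‖ξ + s • (ζ - ξ)‖ ≤ ρ := by
  have h := (convex_closedBall (0 : V) ρ).add_smul_sub_mem (by simpa using hξ)
    (by simpa using hζ) hs
  simpa using h

/-- It suffices to know the increments of an approximate leaf over short segments. -/
theorem norm_increment_le {F : Euc d → Euc d} {ρ c h₀ : ℝ} (hh₀ : 0 < h₀)
    (hF : ∀ ξ₀ ξ₁, ‖ξ₀‖ ≤ ρ → ‖ξ₁‖ ≤ ρ → ‖ξ₁ - ξ₀‖ ≤ h₀ →
      ‖F ξ₁ - F ξ₀ - projAlong Y (E (F ξ₀)) (ξ₁ - ξ₀)‖ ≤ c * ‖ξ₁ - ξ₀‖)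
    {ξ ζ : Euc d} {P : Euc d →L[ℝ] Euc d} {e : ℝ} (hξ : ‖ξ‖ ≤ ρ) (hζ : ‖ζ‖ ≤ ρ)
    (he : ∀ s ∈ Icc (0 : ℝ) 1, ‖projAlong Y (E (F (ξ + s • (ζ - ξ)))) - P‖ ≤ e) :
    ‖F ζ - F ξ - P (ζ - ξ)‖ ≤ (c + e) * ‖ζ - ξ‖ := by
  set Δ := ζ - ξ with hΔ
  have hstep := norm_sub_le_of_small_steps (φ := fun s : ℝ => F (ξ + s • Δ) - s • P Δ)
    (c := (c + e) * ‖Δ‖) (h₀ := h₀ / (‖Δ‖ + 1)) (by positivity) ?_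
  · have h1 : F (ξ + (1 : ℝ) • Δ) - (1 : ℝ) • P Δ - (F (ξ + (0 : ℝ) • Δ) - (0 : ℝ) • P Δ) =
        F ζ - F ξ - P Δ := by
      simp [hΔ]; abel
    simpa only [h1] using hstep
  · intro s h hs hh hsh hhh
    have hs1 : s ∈ Icc (0 : ℝ) 1 := ⟨hs, by linarith⟩
    have hs2 : s + h ∈ Icc (0 : ℝ) 1 := ⟨by linarith, hsh⟩
    have hd : ξ + (s + h) • Δ - (ξ + s • Δ) = h • Δ := by rw [add_smul]; abel
    have hn : ‖h • Δ‖ = h * ‖Δ‖ := by rw [norm_smul, Real.norm_of_nonneg hh]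
    have h1 := hF (ξ + s • Δ) (ξ + (s + h) • Δ) (norm_add_smul_sub_le hξ hζ hs1)
      (norm_add_smul_sub_le hξ hζ hs2) (by
        rw [hd, hn]
        calc h * ‖Δ‖ ≤ h₀ / (‖Δ‖ + 1) * (‖Δ‖ + 1) := by gcongr; linarith
          _ = h₀ := by field_simp)
    rw [hd] at h1
    have h2 : F (ξ + (s + h) • Δ) - (s + h) • P Δ - (F (ξ + s • Δ) - s • P Δ) =
        (F (ξ + (s + h) • Δ) - F (ξ + s • Δ) - projAlong Y (E (F (ξ + s • Δ))) (h • Δ)) +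
        (projAlong Y (E (F (ξ + s • Δ))) - P) (h • Δ) := by
      simp only [_root_.sub_apply, map_smul, add_smul, smul_sub]; abel
    simp only [h2]
    calc _ ≤ c * ‖h • Δ‖ + e * ‖h • Δ‖ := (norm_add_le _ _).trans
          (add_le_add h1 (ContinuousLinearMap.le_of_opNorm_le _ (he s hs1) _))
      _ = (c + e) * ‖Δ‖ * h := by rw [hn]; ring

theorem IsLift.eq_of_zero {K : Set (Euc d)} {T : ℝ} {u : ℝ → Euc d} (hu : IsLift Y E K 0 T u)
    {t : ℝ} (ht : t ∈ Icc 0 T) : u t = u 0 :=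
  constant_of_has_deriv_right_zero hu.continuousOn
    (fun s hs => by
      have := hu.hasDerivWithinAt_Ici hs
      rwa [map_zero] at this) t ht

/-- The second-order error `η` of `transport_estimate` is chosen as `δ / (I e^{MR} + 1)`, so that its
contribution does not exceed that of the smallness hypothesis on `D I e^{Mε}`. -/
theorem mul_distortion_le {D I M C R ε δ x : ℝ} (hD : 0 ≤ D) (hI : 0 ≤ I) (hM : 0 ≤ M)
    (hC : 0 ≤ C) (hR : 0 ≤ R) (hRε : R ≤ ε) (hδ : 0 ≤ δ) (h : D * I * Real.exp (M * ε) ≤ δ)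
    (hx : 0 ≤ x) :
    I * ((D * R * (C * x) + δ / (I * Real.exp (M * R) + 1) * x) * Real.exp (M * R)) ≤
      δ * (R * C + 1) * x := by
  have h1 : D * I * Real.exp (M * R) ≤ δ := le_trans (by gcongr) h
  have h2 : I * Real.exp (M * R) / (I * Real.exp (M * R) + 1) ≤ 1 := by
    rw [div_le_one (by positivity)]; linarith
  calc _ = (D * I * Real.exp (M * R) * (R * C) +
        δ * (I * Real.exp (M * R) / (I * Real.exp (M * R) + 1))) * x := by ring
    _ ≤ (δ * (R * C) + δ * 1) * x := by gcongr
    _ = _ := by ring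

/-- Two lifts from the same point with nearby directions: their endpoints differ by a vector
which is tangent to `E` up to an error controlled by `dA` restricted to `E`. -/
theorem exists_endpoint_increment_le (hc : IsCompatibleCover U Y E O A)
    (hE : ∀ p ∈ U, IsCompl (E p) Y) {p₀ : Euc d} {r C ρ ε δ : ℝ} (hr : 0 < r)
    (hrU : Metric.closedBall p₀ r ⊆ U) (hC0 : 0 ≤ C)
    (hC : ∀ q ∈ Metric.closedBall p₀ r, ‖projAlong Y (E q)‖ ≤ C) (hρ : 0 ≤ ρ)
    (hε : 0 < ε) (hCε : C * ρ ≤ ε) (hδ : 0 < δ)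
    (hX : ⨆ (i : Fin s) (j : Fin s) (l : Fin s), supDRestrict (O i) E (A i) *
      supInv (O j) Y (A j) * expENN ε (supMixed (O l) Y E (A l)) ≤ ENNReal.ofReal δ) :
    ∃ h₀ > 0, ∀ ξ₀ ξ₁ u₀ u₁, ‖ξ₀‖ ≤ ρ → ‖ξ₁‖ ≤ ρ → ‖ξ₁ - ξ₀‖ ≤ h₀ → u₀ 0 = p₀ → u₁ 0 = p₀ →
      IsLift Y E (Metric.closedBall p₀ r) ξ₀ 1 u₀ → IsLift Y E (Metric.closedBall p₀ r) ξ₁ 1 u₁ →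
      ‖u₁ 1 - u₀ 1 - projAlong Y (E (u₀ 1)) (ξ₁ - ξ₀)‖ ≤
        δ * (C * ρ * C + 1) * ‖ξ₁ - ξ₀‖ := by
  have hp₀ : p₀ ∈ Metric.closedBall p₀ r := Metric.mem_closedBall_self hr.le
  have hEr : ∀ q ∈ Metric.closedBall p₀ r, IsCompl (E q) Y := fun q hq => hE q (hrU hq)
  obtain ⟨Kc, hKc, hKO, hKK⟩ := hc.exists_compact_cover (isCompact_closedBall p₀ r) hrU
  obtain ⟨D, I, M, hD, hI, hM, hDIM, hXD, hKI, hKM⟩ :=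
    exists_real_bounds hc hE hKc hKO ⟨p₀, hrU hp₀⟩ hε hδ.le hX
  obtain ⟨L, hL⟩ := ((hc.contDiffOn_projAlong hE).mono hrU).exists_lipschitzOnWith one_ne_zero
    (convex_closedBall p₀ r) (isCompact_closedBall p₀ r)
  have hκ0 : 0 ≤ I * Real.exp (M * (C * ρ)) := by positivity
  have hdA : ∀ i, ∀ q ∈ Kc i, ∀ v ∈ E q, ∀ w, ‖dForm (A i) q v w‖ ≤
      ‖v‖ * (D * ‖projAlong Y (E q) w‖ + M * ‖A i q w‖) := fun i q hq v hv w =>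
    norm_dForm_le_split hc hE (hKO i hq)
      (fun u hu v hv => norm_dForm_le_of_supDRestrict (hc.differentiableAt (hKO i hq)) (hKO i hq)
        hD (hXD i) hu hv) (hKM i q hq) hv w
  obtain ⟨h₀, hh₀, htr⟩ := transport_estimate hc hE hrU hKc hKO hKK hL hC0 hD hM hρ hC
    hdA (η := δ / (I * Real.exp (M * (C * ρ)) + 1)) (by positivity)
  have h01 : (0 : ℝ) ∈ Icc (0 : ℝ) 1 := by simp
  have h11 : (1 : ℝ) ∈ Icc (0 : ℝ) 1 := by simp
  refine ⟨h₀, hh₀, fun ξ₀ ξ₁ u₀ u₁ h0 h1 hh hu0 hu1 hl0 hl1 => ?_⟩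
  have hw0 : u₁ 0 - u₀ 0 = 0 := by rw [hu0, hu1, sub_self]
  have hq := (hl0 1 h11).1
  obtain ⟨i, hi⟩ := hc.exists_mem (hrU (hl0 0 h01).1)
  obtain ⟨j, hj⟩ := mem_iUnion.1 (hKK hq)
  have hH : ∀ t ∈ Icc (0 : ℝ) 1, ‖projAlong Y (E (u₀ t)) (u₁ t - u₀ t)‖ ≤ C * ‖ξ₁ - ξ₀‖ := by
    intro t ht
    rw [hl0.projAlong_sub hl1 hEr ht (hEr _ (hl0 t ht).1), hw0, zero_add]
    refine (ContinuousLinearMap.le_of_opNorm_le _ (hC _ (hl0 t ht).1) _).trans ?_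
    rw [norm_smul, Real.norm_of_nonneg ht.1]
    exact mul_le_mul_of_nonneg_left (mul_le_of_le_one_left (norm_nonneg _) ht.2) hC0
  have hest := htr 1 ξ₀ ξ₁ u₀ u₁ (C * ‖ξ₁ - ξ₀‖) zero_le_one le_rfl h0 h1 hl0 hl1
    (by rw [hw0, norm_zero]; exact hh₀.le) hh hH i j hi (hKO j hj)
  rw [hw0, map_zero, norm_zero, zero_add, norm_zero, zero_add] at hest
  obtain ⟨hsj, hkj⟩ := (hc.2.2.1 j).2 _ (hKO j hj)
  have hpr := hl0.projAlong_sub hl1 hEr h11 (hEr _ hq)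
  rw [hw0, zero_add, one_smul] at hpr
  have hsplit := transInv_apply (hEr _ hq) hsj hkj (u₁ 1 - u₀ 1)
  rw [hpr] at hsplit
  rw [← hsplit]
  refine (ContinuousLinearMap.le_of_opNorm_le _ (hKI j _ hj) _).trans
    ((mul_le_mul_of_nonneg_left hest hI).trans ?_)
  exact mul_distortion_le hD hI hM hC0 (by positivity) hCε hδ.le hDIM (norm_nonneg _)

/-- The endpoints of the lifts of the radial segments form an approximate leaf, provided that `dA`
restricted to `E` is small relative to the distortion. -/
theorem exists_isApproxLeaf (hc : IsCompatibleCover U Y E O A)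
    (hE : ∀ p ∈ U, IsCompl (E p) Y) {p₀ : Euc d} {r C ρ ε δ : ℝ} (hr : 0 < r)
    (hrU : Metric.closedBall p₀ r ⊆ U) (hC0 : 0 ≤ C)
    (hC : ∀ q ∈ Metric.closedBall p₀ r, ‖projAlong Y (E q)‖ ≤ C) (hρ : 0 ≤ ρ)
    (hCr : C * ρ ≤ r / 2) (hε : 0 < ε) (hCε : C * ρ ≤ ε) (hδ : 0 < δ)
    (hX : ⨆ (i : Fin s) (j : Fin s) (l : Fin s), supDRestrict (O i) E (A i) *
      supInv (O j) Y (A j) * expENN ε (supMixed (O l) Y E (A l)) ≤ ENNReal.ofReal δ) :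
    ∃ F, IsApproxLeaf Y E p₀ r ρ (δ * (C * ρ * C + 1)) F := by
  have hEr : ∀ q ∈ Metric.closedBall p₀ r, IsCompl (E q) Y := fun q hq => hE q (hrU hq)
  obtain ⟨L, hL⟩ := ((hc.contDiffOn_projAlong hE).mono hrU).exists_lipschitzOnWith one_ne_zero
    (convex_closedBall p₀ r) (isCompact_closedBall p₀ r)
  have hu : ∀ ξ : Euc d, ∃ u : ℝ → Euc d,
      ‖ξ‖ ≤ ρ → u 0 = p₀ ∧ IsLift Y E (Metric.closedBall p₀ r) ξ 1 u := by
    intro ξ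
    by_cases hξ : ‖ξ‖ ≤ ρ
    · obtain ⟨u, hu⟩ := exists_isLift hL hC hC0 hr.le hCr
        (Metric.mem_closedBall_self (by positivity)) hξ
      exact ⟨u, fun _ => hu⟩
    · exact ⟨fun _ => 0, fun h => absurd h hξ⟩
  choose u hu using hu
  obtain ⟨h₀, hh₀, hinc⟩ := exists_endpoint_increment_le hc hE hr hrU hC0 hC hρ hε hCε hδ hX
  have h11 : (1 : ℝ) ∈ Icc (0 : ℝ) 1 := by simp
  refine ⟨fun ξ => u ξ 1, ?_, fun ξ hξ => ⟨((hu ξ hξ).2 1 h11).1, ?_⟩, ?_⟩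
  · have h := hu 0 (by simpa using hρ)
    exact (h.2.eq_of_zero h11).trans h.1
  · have h := (hu ξ hξ).2.sub_mem hEr h11
    rwa [(hu ξ hξ).1, one_smul] at h
  intro ξ ζ P e hξ hζ he
  exact norm_increment_le hh₀ (fun ξ₀ ξ₁ h0 h1 hh =>
    hinc ξ₀ ξ₁ (u ξ₀) (u ξ₁) h0 h1 hh (hu ξ₀ h0).1 (hu ξ₁ h1).1 (hu ξ₀ h0).2 (hu ξ₁ h1).2) hξ hζ he

/-- An approximate leaf of a bundle is one of every bundle nearby. -/
theorem IsApproxLeaf.of_close {E' : Euc d → Submodule ℝ (Euc d)} {p₀ : Euc d} {r ρ c c' : ℝ}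
    {F : Euc d → Euc d} (hF : IsApproxLeaf Y E' p₀ r ρ c F)
    (h : ∀ q ∈ Metric.closedBall p₀ r, ‖projAlong Y (E' q) - projAlong Y (E q)‖ ≤ c') :
    IsApproxLeaf Y E p₀ r ρ (c + c') F := by
  refine ⟨hF.1, hF.2.1, fun ξ ζ P e hξ hζ he => ?_⟩
  rw [add_assoc]
  refine hF.2.2 ξ ζ P (c' + e) hξ hζ fun s hs => ?_
  exact (norm_sub_le_norm_sub_add_norm_sub _ _ _).trans (add_le_add
    (h _ (hF.2.1 _ (norm_add_smul_sub_le hξ hζ hs)).1) (he s hs))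

/-- A limit of approximate leaves, taken pointwise along an ultrafilter, is a genuine one. -/
theorem exists_limit_leaf {p₀ : Euc d} {r C ρ : ℝ} (hC0 : 0 ≤ C)
    (hC : ∀ q ∈ Metric.closedBall p₀ r, ‖projAlong Y (E q)‖ ≤ C)
    (hcont : ContinuousOn (fun q => projAlong Y (E q)) (Metric.closedBall p₀ r)) (hρ : 0 ≤ ρ)
    (h : ∀ c > 0, ∃ F, IsApproxLeaf Y E p₀ r ρ c F) :
    ∃ F : Euc d → Euc d, F 0 = p₀ ∧
      (∀ ξ, ‖ξ‖ ≤ ρ → F ξ ∈ Metric.closedBall p₀ r ∧ F ξ - (p₀ + ξ) ∈ Y) ∧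
      ∀ ξ, ‖ξ‖ < ρ → HasFDerivAt F (projAlong Y (E (F ξ))) ξ := by
  have hpos : ∀ j : ℕ, (0 : ℝ) < 1 / (j + 1) := fun j => by positivity
  choose Fj hFj using fun j : ℕ => h (1 / (j + 1)) (hpos j)
  set 𝒰 : Ultrafilter ℕ := hyperfilter ℕ
  have h𝒰 : (𝒰 : Filter ℕ) ≤ atTop := Nat.hyperfilter_le_atTop
  have hlim : ∀ ξ : Euc d, ∃ x, ‖ξ‖ ≤ ρ →
      x ∈ Metric.closedBall p₀ r ∧ Tendsto (fun j => Fj j ξ) 𝒰 (𝓝 x) := by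
    intro ξ
    by_cases hξ : ‖ξ‖ ≤ ρ
    · obtain ⟨x, hx, hle⟩ := (isCompact_closedBall p₀ r).ultrafilter_le_nhds
        (𝒰.map fun j => Fj j ξ) (le_principal_iff.2 (Eventually.of_forall fun j =>
          ((hFj j).2.1 ξ hξ).1 : ∀ᶠ j in (𝒰 : Filter ℕ), Fj j ξ ∈ Metric.closedBall p₀ r))
      exact ⟨x, fun _ => ⟨hx, hle⟩⟩
    · exact ⟨0, fun h => absurd h hξ⟩
  choose F hF using hlim
  refine ⟨F, ?_, fun ξ hξ => ⟨(hF ξ hξ).1, ?_⟩, fun ξ hξ => ?_⟩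
  · have h1 := (hF 0 (by simpa using hρ)).2
    simp only [fun j => (hFj j).1] at h1
    exact tendsto_nhds_unique h1 tendsto_const_nhds
  · exact Y.closed_of_finiteDimensional.mem_of_tendsto
      ((hF ξ hξ).2.sub_const (p₀ + ξ)) (Eventually.of_forall fun j => ((hFj j).2.1 ξ hξ).2)
  obtain ⟨hFξ, hξt⟩ := hF ξ hξ.le
  refine HasFDerivAt.of_isLittleO (Asymptotics.isLittleO_iff.2 fun e he => ?_)
  obtain ⟨r₀, hr₀, hr₀e⟩ := Metric.continuousWithinAt_iff.1 (hcont _ hFξ) (e / 2) (by positivity)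
  have hball : ∀ᶠ ζ in 𝓝 ξ, ‖ζ‖ < ρ := continuous_norm.continuousAt.eventually_lt_const hξ
  filter_upwards [hball, Metric.ball_mem_nhds ξ (show 0 < r₀ / (2 * (C + 1)) by positivity)]
    with ζ hζ hζξ
  rw [Metric.mem_ball, dist_eq_norm, lt_div_iff₀ (by positivity)] at hζξ
  have hζt := (hF ζ hζ.le).2
  have hT : Tendsto (fun j => ‖Fj j ζ - Fj j ξ - projAlong Y (E (F ξ)) (ζ - ξ)‖) 𝒰
      (𝓝 ‖F ζ - F ξ - projAlong Y (E (F ξ)) (ζ - ξ)‖) :=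
    ((hζt.sub hξt).sub_const _).norm
  refine le_of_tendsto hT ?_
  have hsmall : Tendsto (fun j : ℕ => (1 : ℝ) / (j + 1)) 𝒰 (𝓝 0) :=
    tendsto_one_div_add_atTop_nhds_zero_nat.mono_left h𝒰
  filter_upwards [hsmall.eventually_lt_const (show (0 : ℝ) < min 1 (e / 2) by positivity),
    hξt.eventually (Metric.ball_mem_nhds _ (half_pos hr₀))] with j hj hjξ
  have hj1 := hj.trans_le (min_le_left _ _)
  have hj2 := hj.trans_le (min_le_right _ _)
  refine ((hFj j).2.2 ξ ζ _ (e / 2) hξ.le hζ.le fun s hs => ?_).trans ?_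
  · have hs' := norm_add_smul_sub_le hξ.le hζ.le hs
    have hmem := ((hFj j).2.1 _ hs').1
    rw [← dist_eq_norm]
    refine (hr₀e hmem ?_).le
    -- comparison with the zero map gives a Lipschitz bound for the approximate leaf
    have h1 := (hFj j).2.2 ξ (ξ + s • (ζ - ξ)) 0 C hξ.le hs' fun t ht => by
      rw [sub_zero]
      exact hC _ ((hFj j).2.1 _ (norm_add_smul_sub_le hξ.le hs' ht)).1
    rw [add_sub_cancel_left, _root_.zero_apply, sub_zero, norm_smul,
      Real.norm_of_nonneg hs.1, ← dist_eq_norm] at h1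
    have h2 : (1 / ((j : ℝ) + 1) + C) * (s * ‖ζ - ξ‖) ≤ (1 + C) * (1 * ‖ζ - ξ‖) := by
      have hs0 := mul_nonneg hs.1 (norm_nonneg (ζ - ξ))
      gcongr
      exact hs.2
    calc _ ≤ dist (Fj j (ξ + s • (ζ - ξ))) (Fj j ξ) + dist (Fj j ξ) (F ξ) := dist_triangle _ _ _
      _ < r₀ / 2 + r₀ / 2 := by
          refine add_lt_add_of_le_of_lt (h1.trans (h2.trans ?_)) hjξ
          linarith
      _ = r₀ := by ring
  · gcongr
    linarith

end Leaf

/-! ### Graphs as integral manifolds -/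

section Graph

variable {d m n : ℕ} {Y X : Submodule ℝ (Euc d)}

/-- Linear coordinates `(x, y)` in which `Y` is the `y`-space and `X` the `x`-space. -/
theorem exists_splitting (h : IsCompl X Y) (hX : Module.finrank ℝ X = m) (hd : d = m + n) :
    ∃ Λ : Euc d ≃L[ℝ] Euc m × Euc n, (∀ v, (Λ v).1 = 0 ↔ v ∈ Y) ∧ ∀ v, (Λ v).2 = 0 ↔ v ∈ X := by
  have hY : Module.finrank ℝ Y = n := by
    have h1 := Submodule.finrank_add_eq_of_isCompl h
    rw [hX, finrank_euclideanSpace_fin] at h1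
    omega
  let eX : X ≃ₗ[ℝ] Euc m := LinearEquiv.ofFinrankEq _ _ (by rw [hX, finrank_euclideanSpace_fin])
  let eY : Y ≃ₗ[ℝ] Euc n := LinearEquiv.ofFinrankEq _ _ (by rw [hY, finrank_euclideanSpace_fin])
  refine ⟨((Submodule.prodEquivOfIsCompl X Y h).symm.trans
    (LinearEquiv.prodCongr eX eY)).toContinuousLinearEquiv, fun v => ?_, fun v => ?_⟩
  · simp
  · simp

theorem IsSubbundle.finrank_eq {U : Set (Euc d)} {E : Euc d → Submodule ℝ (Euc d)}
    {r : WithTop ℕ∞} (hE : IsSubbundle r m U E) {p : Euc d} (hp : p ∈ U) :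
    Module.finrank ℝ (E p) = m := by
  obtain ⟨W, X, -, hpW, -, -, h⟩ := hE p hp
  rw [← (h p hpW).2, finrank_span_eq_card (h p hpW).1, Fintype.card_fin]

/-- A map `F` over a ball of `ℝ^d / Y` whose derivative at `ξ` is the projection onto `E (F ξ)`
along `Y` parametrizes an integral manifold: a shear in the `Y`-directions flattens its graph. -/
theorem exists_integralManifold_of_leaf {U : Set (Euc (m + n))}
    {Y : Submodule ℝ (Euc (m + n))} {E : Euc (m + n) → Submodule ℝ (Euc (m + n))}
    {p₀ : Euc (m + n)} {ρ : ℝ} (hρ : 0 < ρ) {F : Euc (m + n) → Euc (m + n)} (hF0 : F 0 = p₀)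
    (hE : ∀ p ∈ U, IsCompl (E p) Y) (hm : Module.finrank ℝ (E p₀) = m)
    (hcont : ContinuousOn (fun q => projAlong Y (E q)) U) (hFU : ∀ ξ, ‖ξ‖ < ρ → F ξ ∈ U)
    (hFY : ∀ ξ, ‖ξ‖ < ρ → F ξ - (p₀ + ξ) ∈ Y)
    (hF' : ∀ ξ, ‖ξ‖ < ρ → HasFDerivAt F (projAlong Y (E (F ξ))) ξ) :
    ∃ N, IsIntegralManifold m n U E N ∧ p₀ ∈ N := by
  have hp₀ : p₀ ∈ U := hF0 ▸ hFU 0 (by simpa using hρ)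
  have hX := hE p₀ hp₀
  obtain ⟨Λ, -, hΛ2⟩ := exists_splitting hX hm rfl
  set P := projAlong Y (E p₀) with hP
  have hPP : ∀ v, P (P v) = P v := fun v => projAlong_eq_self hX (projAlong_mem hX v)
  have hPF : ∀ ξ, ‖ξ‖ < ρ → P (F ξ) = P p₀ + P ξ := by
    intro ξ hξ
    rw [← map_add]
    exact projAlong_eq_of_sub_mem hX (hFY ξ hξ)
  -- `a p` is the base point over which `p` lies, and `p ↦ a p + (p - F (a p))` is the shear
  let a : Euc (m + n) → Euc (m + n) := fun p => P (p - p₀)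
  let b : Euc m × Euc n → Euc (m + n) := fun z => P (Λ.symm z)
  let src : Set (Euc (m + n)) := {p | ‖a p‖ < ρ}
  let tgt : Set (Euc m × Euc n) := {z | ‖b z‖ < ρ}
  have ha : ContDiff ℝ 1 a := P.contDiff.comp (contDiff_id.sub contDiff_const)
  have hb : ContDiff ℝ 1 b := P.contDiff.comp Λ.symm.contDiff
  have hsrc : IsOpen src := isOpen_lt ha.continuous.norm continuous_const
  have htgt : IsOpen tgt := isOpen_lt hb.continuous.norm continuous_const
  have hFdiff : ContDiffOn ℝ 1 F (Metric.ball 0 ρ) := by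
    have hd : DifferentiableOn ℝ F (Metric.ball 0 ρ) := fun ξ hξ =>
      (hF' ξ (by simpa using hξ)).differentiableAt.differentiableWithinAt
    rw [show (1 : WithTop ℕ∞) = 0 + 1 by simp, contDiffOn_succ_iff_fderiv_of_isOpen
      Metric.isOpen_ball]
    refine ⟨hd, by simp, contDiffOn_zero.2 ?_⟩
    refine (hcont.comp hd.continuousOn fun ξ hξ => hFU ξ (by simpa using hξ)).congr fun ξ hξ => ?_
    exact (hF' ξ (by simpa using hξ)).fderiv
  have hFa : ContDiffOn ℝ 1 (fun p => F (a p)) src :=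
    hFdiff.comp ha.contDiffOn fun p hp => by simpa using! hp
  have hFb : ContDiffOn ℝ 1 (fun z => F (b z)) tgt :=
    hFdiff.comp hb.contDiffOn fun z hz => by simpa using! hz
  let f : Euc (m + n) → Euc m × Euc n := fun p => Λ (a p + (p - F (a p)))
  let g : Euc m × Euc n → Euc (m + n) := fun z => Λ.symm z - b z + F (b z)
  have hf : ContDiffOn ℝ 1 f src :=
    Λ.contDiff.comp_contDiffOn (ha.contDiffOn.add (contDiffOn_id.sub hFa))
  have hg : ContDiffOn ℝ 1 g tgt := (Λ.symm.contDiff.contDiffOn.sub hb.contDiffOn).add hFb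
  have hbf : ∀ p ∈ src, b (f p) = a p := by
    intro p hp
    have h1 := hPF (a p) hp
    simp only [b, f, ContinuousLinearEquiv.symm_apply_apply, map_add, map_sub, h1]
    simp only [a, hPP, map_sub]
    abel
  have hag : ∀ z ∈ tgt, a (g z) = b z := by
    intro z hz
    have h1 := hPF (b z) hz
    simp only [a, g, map_add, map_sub, h1]
    simp only [b, hPP]
    abel
  let φ : OpenPartialHomeomorph (Euc (m + n)) (Euc m × Euc n) :=
    { toFun := f
      invFun := g
      source := src
      target := tgt
      map_source' := fun p hp => by
        change ‖b (f p)‖ < ρ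
        rw [hbf p hp]; exact hp
      map_target' := fun z hz => by
        change ‖a (g z)‖ < ρ
        rw [hag z hz]; exact hz
      left_inv' := fun p hp => by
        simp only [g, hbf p hp]
        simp [f]
      right_inv' := fun z hz => by
        simp only [f, hag z hz]
        simp [g]
      open_source := hsrc
      open_target := htgt
      continuousOn_toFun := hf.continuousOn
      continuousOn_invFun := hg.continuousOn }
  have hsub : ∀ p ∈ src, p - F (a p) ∈ Y := by
    intro p hp
    have h1 := Y.sub_mem (sub_projAlong_mem hX (p - p₀)) (hFY (a p) hp)
    convert h1 using 1
    simp only [a]; abel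
  refine ⟨{p | p ∈ src ∧ F (a p) = p}, ⟨?_, ?_⟩, ?_, ?_⟩
  · rintro p ⟨hp, hFp⟩
    rw [← hFp]; exact hFU _ hp
  · rintro p ⟨hp, hFp⟩
    have hpU : p ∈ U := hFp ▸ hFU _ hp
    have hpE := hE p hpU
    refine ⟨φ, hp, hf, hg, fun q hq => ?_, fun v => ?_⟩
    · have h1 : (φ q).2 = 0 ↔ a q + (q - F (a q)) ∈ E p₀ := hΛ2 _
      have h2 : a q ∈ E p₀ := projAlong_mem hX _
      rw [h1, Submodule.add_mem_iff_right _ h2]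
      constructor
      · rintro ⟨-, hFq⟩
        rw [hFq, sub_self]; exact Submodule.zero_mem _
      · intro h3
        have h4 : q - F (a q) ∈ E p₀ ⊓ Y := ⟨h3, hsub q hq⟩
        rw [hX.inf_eq_bot, Submodule.mem_bot, sub_eq_zero] at h4
        exact ⟨hq, h4.symm⟩
    · have hda : HasFDerivAt a P p := P.hasFDerivAt.comp p ((hasFDerivAt_id p).sub_const p₀)
      have hdF := (hF' (a p) hp).comp p hda
      rw [hFp] at hdF
      have hdf : HasFDerivAt f ((Λ : Euc (m + n) →L[ℝ] Euc m × Euc n) ∘L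
          (P + (ContinuousLinearMap.id ℝ _ - projAlong Y (E p) ∘L P))) p :=
        Λ.hasFDerivAt.comp p (hda.add ((hasFDerivAt_id p).sub hdF))
      have h1 : fderiv ℝ φ p = _ := hdf.fderiv
      have h2 : projAlong Y (E p) (P v) = projAlong Y (E p) v :=
        (projAlong_eq_of_sub_mem hpE (sub_projAlong_mem hX v)).symm
      rw [h1]
      have h3 : ((Λ : Euc (m + n) →L[ℝ] Euc m × Euc n) ∘L
          (P + (ContinuousLinearMap.id ℝ _ - projAlong Y (E p) ∘L P))) v =
          Λ (P v + (v - projAlong Y (E p) v)) := by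
        simp [h2]
      rw [h3, hΛ2, Submodule.add_mem_iff_right _ (projAlong_mem hX v)]
      constructor
      · intro hv
        rw [projAlong_eq_self hpE hv, sub_self]; exact Submodule.zero_mem _
      · intro h4
        have h5 : v - projAlong Y (E p) v ∈ E p₀ ⊓ Y := ⟨h4, sub_projAlong_mem hpE v⟩
        rw [hX.inf_eq_bot, Submodule.mem_bot, sub_eq_zero] at h5
        exact (projAlong_eq_self_iff hpE).1 h5.symm
  · simp [src, a, hρ]
  · simp [a, hF0]

/-- Asymptotically involutive bundles are integrable. -/
theorem AsymptoticallyInvolutive.integrable {U : Set (Euc (m + n))} (hU : IsOpen U)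
    {E : Euc (m + n) → Submodule ℝ (Euc (m + n))} (hE : IsSubbundle 0 m U E)
    (h : AsymptoticallyInvolutive m n U E) : Integrable m n U E := by
  obtain ⟨Y, hY, Ek, ⟨-, hk, hconv⟩, ε, hε, s, O, A, hc, hlim⟩ := h
  intro p₀ hp₀
  have hcont := hE.continuousOn_projAlong hY
  obtain ⟨r, hr, C, hC0, hrU, hC, hCk, hunif⟩ :=
    exists_ball_uniform_convergence hU hE hY hk hconv hp₀
  -- the size of the leaf is limited by the ball and by the time `ε` in the exponential
  set ρ := min (r / 2) ε / C with hρdef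
  have hρ : 0 < ρ := by positivity
  have hCρ : C * ρ = min (r / 2) ε := by rw [hρdef]; field_simp
  have happrox : ∀ c > 0, ∃ F, IsApproxLeaf Y E p₀ r ρ c F := by
    intro c hc'
    set δ := c / 2 / (C * ρ * C + 1) with hδdef
    have hδ : 0 < δ := by positivity
    have hev := hlim.eventually (gt_mem_nhds (ENNReal.ofReal_pos.2 hδ))
    obtain ⟨k, h1, h2, h3⟩ := (hev.and (hCk.and (hunif (c / 2) (by positivity)))).exists
    obtain ⟨F, hF⟩ := exists_isApproxLeaf (hc k) (hk k) hr hrU hC0.le h2 hρ.le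
      (hCρ.le.trans (min_le_left _ _)) hε (hCρ.le.trans (min_le_right _ _)) hδ h1.le
    refine ⟨F, ?_⟩
    have h4 := hF.of_close h3
    have h5 : δ * (C * ρ * C + 1) + c / 2 = c := by rw [hδdef]; field_simp; ring
    rwa [h5] at h4
  obtain ⟨F, hF0, hFm, hF'⟩ := exists_limit_leaf hC0.le hC (hcont.mono hrU) hρ.le happrox
  exact exists_integralManifold_of_leaf hρ hF0 hY (hE.finrank_eq hp₀) hcont
    (fun ξ hξ => hrU (hFm ξ hξ.le).1) (fun ξ hξ => (hFm ξ hξ.le).2) hF'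

end Graph

/-! ### Uniqueness of lifts for exterior regular bundles -/

section Uniqueness

variable {d n s : ℕ} {U : Set (Euc d)} {Y : Submodule ℝ (Euc d)}
  {E E' : Euc d → Submodule ℝ (Euc d)} {O : Fin s → Set (Euc d)} {A : Fin s → FormTuple d n}
  {K : Set (Euc d)} {ξ : Euc d}

theorem IsLift.norm_sub_zero_le {C ρ T : ℝ} {u : ℝ → Euc d} (hu : IsLift Y E K ξ T u)
    (hC : ∀ q ∈ K, ‖projAlong Y (E q)‖ ≤ C) (hξ : ‖ξ‖ ≤ ρ) {t : ℝ} (ht : t ∈ Icc 0 T) :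
    ‖u t - u 0‖ ≤ C * ρ * t := by
  have hC0 : 0 ≤ C := (norm_nonneg _).trans (hC _ (hu t ht).1)
  have h := norm_image_sub_le_of_norm_deriv_right_le_segment hu.continuousOn
    (fun s hs => hu.hasDerivWithinAt_Ici hs) (C := C * ρ) (fun s hs =>
      (ContinuousLinearMap.le_of_opNorm_le _ (hC _ (hu s (Ico_subset_Icc_self hs)).1) ξ).trans
        (by gcongr)) t ht
  simpa using h

/-- The transverse part of the difference between a curve tangent to `E` and a curve tangent to
`E' = ker L`, after a short time `h`: it is at most `h` times the norm of `L` on `E`. -/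
theorem norm_apply_sub_le_of_lifts {C ρ T b c ω h : ℝ} {γ u : ℝ → Euc d}
    (hγ : IsLift Y E K ξ T γ) (hu : IsLift Y E' K ξ T u) (h0 : γ 0 = u 0)
    (hC : ∀ q ∈ K, ‖projAlong Y (E q)‖ ≤ C) (hC' : ∀ q ∈ K, ‖projAlong Y (E' q)‖ ≤ C)
    (hξ : ‖ξ‖ ≤ ρ) (hb : 0 ≤ b) (hh : h ∈ Icc 0 T) {L : Euc d →L[ℝ] Euc n} (hL : ‖L‖ ≤ c)
    (hLE : ∀ v, ‖L (projAlong Y (E (u h)) v)‖ ≤ b * ‖projAlong Y (E (u h)) v‖)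
    (hLE' : ∀ v, L (projAlong Y (E' (u h)) v) = 0)
    (hω : ∀ x ∈ K, ‖x - u h‖ ≤ 2 * (C * ρ) * h →
      ‖projAlong Y (E x) - projAlong Y (E (u h))‖ ≤ ω ∧
      ‖projAlong Y (E' x) - projAlong Y (E' (u h))‖ ≤ ω) :
    ‖L (γ h - u h)‖ ≤ (b * (C * ρ) + 2 * (c * ω * ρ)) * h := by
  have hc0 : 0 ≤ c := (norm_nonneg _).trans hL
  have hρ0 : 0 ≤ ρ := (norm_nonneg _).trans hξ
  have hC0 : 0 ≤ C := (norm_nonneg _).trans (hC' _ (hu h hh).1)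
  have hω0 : 0 ≤ ω := (norm_nonneg _).trans (hω _ (hu h hh).1 (by
    rw [sub_self, norm_zero]; have := hh.1; positivity)).1
  have hγ' := hγ.mono hh.2
  have hu' := hu.mono hh.2
  have hhm : h ∈ Icc 0 h := ⟨hh.1, le_rfl⟩
  have hd : ∀ t ∈ Ico 0 h, HasDerivWithinAt (fun t => L (γ t - u t))
      (L (projAlong Y (E (γ t)) ξ - projAlong Y (E' (u t)) ξ)) (Ici t) t := fun t ht =>
    L.hasFDerivAt.comp_hasDerivWithinAt t
      ((hγ'.hasDerivWithinAt_Ici ht).sub (hu'.hasDerivWithinAt_Ici ht))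
  have hbd : ∀ t ∈ Ico 0 h, ‖L (projAlong Y (E (γ t)) ξ - projAlong Y (E' (u t)) ξ)‖ ≤
      b * (C * ρ) + 2 * (c * ω * ρ) := by
    intro t ht
    have htI := Ico_subset_Icc_self ht
    have hut : ‖u t - u 0‖ ≤ C * ρ * h :=
      (hu'.norm_sub_zero_le hC' hξ htI).trans (by gcongr; exact ht.2.le)
    have hγt : ‖γ t - u 0‖ ≤ C * ρ * h := h0 ▸
      (hγ'.norm_sub_zero_le hC hξ htI).trans (by gcongr; exact ht.2.le)
    have huh : ‖u 0 - u h‖ ≤ C * ρ * h := by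
      rw [norm_sub_rev]; exact hu'.norm_sub_zero_le hC' hξ hhm
    have h1 := (hω _ (hγ' t htI).1 (by
      linarith [norm_sub_le_norm_sub_add_norm_sub (γ t) (u 0) (u h)])).1
    have h2 := (hω _ (hu' t htI).1 (by
      linarith [norm_sub_le_norm_sub_add_norm_sub (u t) (u 0) (u h)])).2
    have h3 : L (projAlong Y (E (γ t)) ξ - projAlong Y (E' (u t)) ξ) =
        L (projAlong Y (E (u h)) ξ) +
        (L ((projAlong Y (E (γ t)) - projAlong Y (E (u h))) ξ) -
        L ((projAlong Y (E' (u t)) - projAlong Y (E' (u h))) ξ)) := by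
      simp only [_root_.sub_apply, map_sub, hLE']; abel
    have h4 : ∀ Q : Euc d →L[ℝ] Euc d, ‖Q‖ ≤ ω → ‖L (Q ξ)‖ ≤ c * ω * ρ := fun Q hQ => by
      calc ‖L (Q ξ)‖ ≤ c * ‖Q ξ‖ := ContinuousLinearMap.le_of_opNorm_le _ hL _
        _ ≤ c * (ω * ‖ξ‖) := by gcongr; exact ContinuousLinearMap.le_of_opNorm_le _ hQ _
        _ ≤ c * (ω * ρ) := by gcongr
        _ = _ := by ring
    rw [h3]
    refine (norm_add_le _ _).trans (add_le_add ?_ ?_)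
    · refine (hLE ξ).trans ?_
      gcongr
      exact (ContinuousLinearMap.le_of_opNorm_le _ (hC _ (hu h hh).1) ξ).trans (by gcongr)
    · refine (norm_sub_le _ _).trans ?_
      linarith [h4 _ h1, h4 _ h2]
  have hcont : ContinuousOn (fun t => L (γ t - u t)) (Icc 0 h) :=
    L.continuous.comp_continuousOn (hγ'.continuousOn.sub hu'.continuousOn)
  have := norm_image_sub_le_of_norm_deriv_right_le_segment hcont hd hbd h hhm
  simpa [h0] using this

/-- The choice of the second-order error `η` in the uniqueness estimate, as in
`mul_distortion_le`. -/
theorem add_distortion_le {b I M C ρ ε δ : ℝ} (hb : 0 ≤ b) (hI : 0 ≤ I) (hM : 0 ≤ M)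
    (hR : 0 ≤ C * ρ) (hRε : C * ρ ≤ ε) (hδ : 0 ≤ δ) (h : b * I * Real.exp (M * ε) ≤ δ) :
    I * ((b * (C * ρ) + δ / (I * Real.exp (M * (C * ρ)) * (1 + 2 * (C * ρ)) + 1) *
      (1 + 2 * (C * ρ))) * Real.exp (M * (C * ρ))) ≤ δ * (C * ρ + 1) := by
  have h1 : b * I * Real.exp (M * (C * ρ)) ≤ δ := le_trans (by gcongr) h
  have h2 : I * Real.exp (M * (C * ρ)) * (1 + 2 * (C * ρ)) /
      (I * Real.exp (M * (C * ρ)) * (1 + 2 * (C * ρ)) + 1) ≤ 1 := by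
    rw [div_le_one (by positivity)]; linarith
  calc _ = b * I * Real.exp (M * (C * ρ)) * (C * ρ) +
        δ * (I * Real.exp (M * (C * ρ)) * (1 + 2 * (C * ρ)) /
          (I * Real.exp (M * (C * ρ)) * (1 + 2 * (C * ρ)) + 1)) := by ring
    _ ≤ δ * (C * ρ) + δ * 1 := by gcongr
    _ = _ := by ring

/-- A curve `γ` tangent to `E` and the lift of the same segment to the approximating bundle `E'`
from the same point stay close.  The lift to `E'` starting at `γ s` and running for the time
`1 - s` ends at a point which moves, as `s` goes from `0` to `1`, from the end of the lift to the
end of `γ`; its speed is the transverse part of `γ'`, transported along `E'`. -/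
theorem norm_sub_le_of_supRestrict (hc : IsCompatibleCover U Y E' O A)
    (hE : ∀ p ∈ U, IsCompl (E p) Y) (hE' : ∀ p ∈ U, IsCompl (E' p) Y)
    {p₀ : Euc d} {r C ρ ε δ : ℝ} (hr : 0 < r)
    (hrU : Metric.closedBall p₀ r ⊆ U) (hC0 : 0 ≤ C)
    (hC : ∀ q ∈ Metric.closedBall p₀ r, ‖projAlong Y (E q)‖ ≤ C)
    (hC' : ∀ q ∈ Metric.closedBall p₀ r, ‖projAlong Y (E' q)‖ ≤ C)
    (hcont : ContinuousOn (fun q => projAlong Y (E q)) U) (hξ : ‖ξ‖ ≤ ρ)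
    (hε : 0 < ε) (hCε : C * ρ ≤ ε) (hδ : 0 < δ)
    (hX : ⨆ (i : Fin s) (j : Fin s) (l : Fin s), supRestrict (O i) E (A i) *
      supInv (O j) Y (A j) * expENN ε (supMixed (O l) Y E' (A l)) ≤ ENNReal.ofReal δ)
    {Φ : Euc d → ℝ → Euc d} (hΦ : ∀ p ∈ Metric.closedBall p₀ (r / 2),
      Φ p 0 = p ∧ IsLift Y E' (Metric.closedBall p₀ r) ξ 1 (Φ p))
    {γ : ℝ → Euc d} (hγ : IsLift Y E (Metric.closedBall p₀ (r / 2)) ξ 1 γ) :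
    ‖γ 1 - Φ (γ 0) 1‖ ≤ δ * (C * ρ + 1) := by
  have hρ : 0 ≤ ρ := (norm_nonneg _).trans hξ
  set K := Metric.closedBall p₀ r with hK
  have hKc' : IsCompact K := isCompact_closedBall p₀ r
  have hhalf : Metric.closedBall p₀ (r / 2) ⊆ K :=
    Metric.closedBall_subset_closedBall (by linarith)
  have hp₀ : p₀ ∈ K := Metric.mem_closedBall_self hr.le
  have hEK : ∀ q ∈ K, IsCompl (E q) Y := fun q hq => hE q (hrU hq)
  have hEK' : ∀ q ∈ K, IsCompl (E' q) Y := fun q hq => hE' q (hrU hq)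
  have hγK : IsLift Y E K ξ 1 γ := fun t ht => ⟨hhalf (hγ t ht).1, (hγ t ht).2⟩
  obtain ⟨Kc, hKc, hKO, hKK⟩ := hc.exists_compact_cover hKc' hrU
  obtain ⟨b, I, M, hb, hI, hM, hbIM, hXb, hKI, hKM⟩ :=
    exists_real_bounds hc hE' hKc hKO ⟨p₀, hrU hp₀⟩ hε hδ.le hX
  obtain ⟨D, hD, hDb⟩ := exists_local_bounds hc hE' hKc hKO
  have hcont' := hc.contDiffOn_projAlong hE'
  obtain ⟨L, hL⟩ := (hcont'.mono hrU).exists_lipschitzOnWith one_ne_zero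
    (convex_closedBall p₀ r) hKc'
  have hdA : ∀ i, ∀ q ∈ Kc i, ∀ v ∈ E' q, ∀ w, ‖dForm (A i) q v w‖ ≤
      ‖v‖ * (D * ‖projAlong Y (E' q) w‖ + M * ‖A i q w‖) := fun i q hq v hv w =>
    norm_dForm_le_split hc hE' (hKO i hq) (fun u _ v _ => (hDb i q hq).2.1 u v) (hKM i q hq) hv w
  obtain ⟨CA, hCA0, hCA⟩ : ∃ CA : ℝ, 0 ≤ CA ∧ ∀ i, ∀ q ∈ Kc i, ‖A i q‖ ≤ CA := by
    have h1 : ∀ i, ∃ c : ℝ, ∀ q ∈ Kc i, ‖A i q‖ ≤ c := fun i =>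
      (hKc i).exists_bound_of_continuousOn ((hc.2.2.1 i).1.continuousOn.mono (hKO i))
    choose c hcb using h1
    obtain ⟨CA, hCA⟩ := Finite.exists_le c
    exact ⟨|CA|, abs_nonneg _, fun i q hq =>
      ((hcb i q hq).trans (hCA i)).trans (le_abs_self _)⟩
  have hR : 0 ≤ C * ρ := by positivity
  set η := δ / (I * Real.exp (M * (C * ρ)) * (1 + 2 * (C * ρ)) + 1) with hη
  have hη0 : 0 < η := by positivity
  obtain ⟨δ₁, hδ₁, htr⟩ := transport_estimate hc hE' hrU hKc hKO hKK hL hC0 hD hM hρ hC'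
    hdA hη0
  -- the modulus of continuity for which `2 CA ω ρ ≤ η`
  set ω := η / (2 * (CA * ρ + 1)) with hωdef
  have hω0 : 0 < ω := by positivity
  have hωη : 2 * (CA * ω * ρ) ≤ η := by
    have h1 : CA * ρ / (CA * ρ + 1) ≤ 1 := by rw [div_le_one (by positivity)]; linarith
    calc 2 * (CA * ω * ρ) = η * (CA * ρ / (CA * ρ + 1)) := by rw [hωdef]; field_simp
      _ ≤ η * 1 := by gcongr
      _ = η := mul_one _
  obtain ⟨δ₂, hδ₂, hu₂⟩ := Metric.uniformContinuousOn_iff.1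
    (hKc'.uniformContinuousOn_of_continuous (hcont.mono hrU)) ω hω0
  obtain ⟨δ₃, hδ₃, hu₃⟩ := Metric.uniformContinuousOn_iff.1
    (hKc'.uniformContinuousOn_of_continuous (hcont'.continuousOn.mono hrU)) ω hω0
  set h₀ := min δ₁ (min δ₂ δ₃) / (2 * (C * ρ) + 1) with hh₀
  have hh₀pos : 0 < h₀ := by positivity
  have hh₀lt : 2 * (C * ρ) * h₀ < min δ₁ (min δ₂ δ₃) := by
    have : h₀ * (2 * (C * ρ) + 1) = min δ₁ (min δ₂ δ₃) := by rw [hh₀]; field_simp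
    linarith
  have h01 : (0 : ℝ) ∈ Icc (0 : ℝ) 1 := by simp
  have h11 : (1 : ℝ) ∈ Icc (0 : ℝ) 1 := by simp
  have hstep := norm_sub_le_of_small_steps (φ := fun s : ℝ => Φ (γ s) (1 - s))
    (c := δ * (C * ρ + 1)) hh₀pos ?_
  · simp only [sub_self, sub_zero] at hstep
    rwa [(hΦ _ (hγ 1 h11).1).1] at hstep
  intro s h hs hh hsh hhh
  have hsI : s ∈ Icc (0 : ℝ) 1 := ⟨hs, by linarith⟩
  have hshI : s + h ∈ Icc (0 : ℝ) 1 := ⟨by linarith, hsh⟩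
  obtain ⟨hΦ0, hΦl⟩ := hΦ _ (hγ s hsI).1
  obtain ⟨hΦ0', hΦl'⟩ := hΦ _ (hγ (s + h) hshI).1
  have hγs : IsLift Y E K ξ (1 - s) (fun t => γ (t + s)) := hγK.shift hs (by linarith)
  have hus : IsLift Y E' K ξ (1 - s) (Φ (γ s)) := hΦl.mono (by linarith)
  have hhI : h ∈ Icc 0 (1 - s) := ⟨hh, by linarith⟩
  have hl0 : IsLift Y E' K ξ (1 - (s + h)) (fun t => Φ (γ s) (t + h)) :=
    hΦl.shift hh (by linarith)
  have hl1 : IsLift Y E' K ξ (1 - (s + h)) (Φ (γ (s + h))) := hΦl'.mono (by linarith)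
  have hstart : γ (0 + s) = Φ (γ s) 0 := by rw [zero_add, hΦ0]
  have hhlt : 2 * (C * ρ) * h < min δ₁ (min δ₂ δ₃) :=
    lt_of_le_of_lt (by gcongr) hh₀lt
  -- the lift from `γ (s + h)` is compared with the lift from `γ s`, which has a head start of `h`
  have hw₀ : Φ (γ (s + h)) 0 - Φ (γ s) h = γ (h + s) - Φ (γ s) h := by
    rw [hΦ0', add_comm s h]
  have hw : Φ (γ (s + h)) 0 - Φ (γ s) (0 + h) = γ (h + s) - Φ (γ s) h := by
    rw [zero_add, hw₀]
  have hwn : ‖γ (h + s) - Φ (γ s) h‖ ≤ 2 * (C * ρ) * h := by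
    have h1 := hγs.norm_sub_zero_le hC hξ hhI
    have h2 := hus.norm_sub_zero_le hC' hξ hhI
    simp only [hstart] at h1
    rw [norm_sub_rev] at h2
    linarith [norm_sub_le_norm_sub_add_norm_sub (γ (h + s)) (Φ (γ s) 0) (Φ (γ s) h)]
  have hwY : γ (h + s) - Φ (γ s) h ∈ Y := by
    have h1 := Y.sub_mem (hγs.sub_mem hEK hhI) (hus.sub_mem hEK' hhI)
    simpa [hstart, hΦ0] using h1
  have hq := (hus h hhI).1
  obtain ⟨i, hi⟩ := mem_iUnion.1 (hKK hq)
  obtain ⟨-, hki⟩ := (hc.2.2.1 i).2 _ (hKO i hi)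
  have hinit : ‖A i (Φ (γ s) h) (γ (h + s) - Φ (γ s) h)‖ ≤ (b * (C * ρ) + η) * h := by
    refine (norm_apply_sub_le_of_lifts hγs hus hstart hC hC' hξ hb hhI (hCA i _ hi)
      (fun v => ?_) (fun v => apply_projAlong (hEK' _ hq) hki v) (ω := ω)
      fun x hx hxh => ⟨?_, ?_⟩).trans ?_
    · exact norm_apply_le_of_unit (A i (Φ (γ s) h)).toLinearMap (E (Φ (γ s) h))
        (fun u hu hu1 => norm_le_of_enorm_le_ofReal hb
          ((le_supRestrict (hKO i hi) hu hu1).trans (hXb i))) (projAlong_mem (hEK _ hq) v)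
    · rw [← dist_eq_norm]
      refine (hu₂ x hx _ hq ?_).le
      rw [dist_eq_norm]
      exact hxh.trans_lt (hhlt.trans_le ((min_le_right _ _).trans (min_le_left _ _)))
    · rw [← dist_eq_norm]
      refine (hu₃ x hx _ hq ?_).le
      rw [dist_eq_norm]
      exact hxh.trans_lt (hhlt.trans_le ((min_le_right _ _).trans (min_le_right _ _)))
    · gcongr
  have hT : (1 : ℝ) - (s + h) ∈ Icc 0 (1 - (s + h)) := ⟨by linarith, le_rfl⟩
  have hproj : ∀ t ∈ Icc 0 (1 - (s + h)), ∀ x ∈ K,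
      projAlong Y (E' x) (Φ (γ (s + h)) t - Φ (γ s) (t + h)) = 0 := by
    intro t ht x hx
    have h1 := hl0.projAlong_sub hl1 hEK' ht (hEK' x hx)
    simp only [sub_self, smul_zero, add_zero, hw] at h1
    rw [h1]
    exact projAlong_eq_zero (hEK' x hx) hwY
  have hend := (hl0 _ hT).1
  obtain ⟨j, hj⟩ := mem_iUnion.1 (hKK hend)
  obtain ⟨hsj, hkj⟩ := (hc.2.2.1 j).2 _ (hKO j hj)
  have hest := htr (1 - (s + h)) ξ ξ _ _ 0 (by linarith) (by linarith) hξ hξ hl0 hl1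
    (by rw [hw]; exact hwn.trans (hhlt.le.trans (min_le_left _ _)))
    (by rw [sub_self, norm_zero]; exact hδ₁.le)
    (fun t ht => by rw [hproj t ht _ (hl0 t ht).1, norm_zero]) i j
    (by simpa using hKO i hi) (hKO j hj)
  simp only [hw₀, zero_add, sub_self, norm_zero, mul_zero, add_zero] at hest
  have hsplit := transInv_apply (hEK' _ hend) hsj hkj
    (Φ (γ (s + h)) (1 - (s + h)) - Φ (γ s) (1 - (s + h) + h))
  rw [hproj _ hT _ hend, sub_zero] at hsplit
  have hTs : 1 - (s + h) + h = 1 - s := by ring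
  -- the displacement lies in `Y`, where `A⁻¹` inverts `A`
  have hfin : ‖Φ (γ (s + h)) (1 - (s + h)) - Φ (γ s) (1 - (s + h) + h)‖ ≤
      I * ((((b * (C * ρ) + η) * h) + η * (2 * (C * ρ) * h)) * Real.exp (M * (C * ρ))) := by
    calc _ ≤ I * ‖A j (Φ (γ s) (1 - (s + h) + h))
          (Φ (γ (s + h)) (1 - (s + h)) - Φ (γ s) (1 - (s + h) + h))‖ := by
          nth_rewrite 1 [← hsplit]
          exact ContinuousLinearMap.le_of_opNorm_le _ (hKI j _ hj) _
      _ ≤ _ := by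
          refine mul_le_mul_of_nonneg_left (hest.trans ?_) hI
          gcongr
  rw [hTs] at hfin
  refine hfin.trans ?_
  have := mul_le_mul_of_nonneg_right
    (add_distortion_le hb hI hM hR hCε hδ.le hbIM) hh
  refine le_trans (le_of_eq ?_) this
  rw [← hη]; ring

end Uniqueness

/-! ### Intersections of integral manifolds -/

section Intersection

variable {m n : ℕ} {U N : Set (Euc (m + n))} {Y : Submodule ℝ (Euc (m + n))}
  {E : Euc (m + n) → Submodule ℝ (Euc (m + n))}

/-- A curve in an integral manifold is tangent to the bundle. -/
theorem IsIntegralManifold.mem_of_hasDerivAt (hN : IsIntegralManifold m n U E N)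
    {γ : ℝ → Euc (m + n)} {v : Euc (m + n)} {t : ℝ} (hγ : HasDerivAt γ v t)
    (hγN : ∀ᶠ s in 𝓝 t, γ s ∈ N) : v ∈ E (γ t) := by
  obtain ⟨φ, hsrc, hφ, -, hφN, hφE⟩ := hN.2 (γ t) hγN.self_of_nhds
  rw [hφE]
  have hd : HasFDerivAt φ (fderiv ℝ φ (γ t)) (γ t) :=
    ((hφ.contDiffAt (φ.open_source.mem_nhds hsrc)).differentiableAt one_ne_zero).hasFDerivAt
  have h1 : HasDerivAt (fun s => (φ (γ s)).2) (fderiv ℝ φ (γ t) v).2 t :=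
    (ContinuousLinearMap.snd ℝ (Euc m) (Euc n)).hasFDerivAt.comp_hasDerivAt t
      (hd.comp_hasDerivAt t hγ)
  have h2 : (fun s => (φ (γ s)).2) =ᶠ[𝓝 t] fun _ => 0 := by
    filter_upwards [hγN, hγ.continuousAt.eventually (φ.open_source.mem_nhds hsrc)] with s hs hs'
    exact (hφN _ hs').1 hs
  exact h1.unique ((hasDerivAt_const t (0 : Euc n)).congr_of_eventuallyEq h2)

/-- Near each of its points, an integral manifold is swept out by lifts of radial segments. -/
theorem IsIntegralManifold.exists_lifts (hN : IsIntegralManifold m n U E N)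
    (hE : ∀ p ∈ U, IsCompl (E p) Y) {p : Euc (m + n)} (hp : p ∈ N)
    (hm : Module.finrank ℝ (E p) = m) {R : ℝ} (hR : 0 < R) :
    ∃ Γ : Euc (m + n) → ℝ → Euc (m + n),
      (∀ᶠ ξ in 𝓝 0, Γ ξ 0 = p ∧ IsLift Y E (N ∩ Metric.closedBall p R) ξ 1 (Γ ξ)) ∧
      ∀ᶠ q in 𝓝 p, q ∈ N → Γ (q - p) 1 = q := by
  have hpU := hN.1 hp
  have hpE := hE p hpU
  obtain ⟨Λ, hΛ1, -⟩ := exists_splitting hpE hm rfl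
  obtain ⟨φ, hsrc, hφ, -, hφN, hφE⟩ := hN.2 p hp
  have hφp : ContDiffAt ℝ 1 φ p := hφ.contDiffAt (φ.open_source.mem_nhds hsrc)
  -- coordinates near `p`: the first component is the base point in `ℝ^d / Y`
  let θ : Euc (m + n) → Euc m × Euc n := fun q => ((Λ (q - p)).1, (φ q).2)
  have hθ : ContDiffAt ℝ 1 θ p := by
    have h1 : ContDiff ℝ 1 fun q => (Λ (q - p)).1 :=
      contDiff_fst.comp (Λ.contDiff.comp (contDiff_id.sub contDiff_const))
    exact h1.contDiffAt.prodMk (contDiffAt_snd.comp p hφp)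
  let θ' : Euc (m + n) →L[ℝ] Euc m × Euc n :=
    (ContinuousLinearMap.fst ℝ (Euc m) (Euc n) ∘L (Λ : Euc (m + n) →L[ℝ] Euc m × Euc n)).prod
      (ContinuousLinearMap.snd ℝ (Euc m) (Euc n) ∘L fderiv ℝ φ p)
  have hθ'app : ∀ v, θ' v = ((Λ v).1, (fderiv ℝ φ p v).2) := fun v => rfl
  have hθ' : HasFDerivAt θ θ' p := by
    have h1 : HasFDerivAt (fun q => Λ (q - p)) (Λ : Euc (m + n) →L[ℝ] Euc m × Euc n) p :=
      Λ.hasFDerivAt.comp p ((hasFDerivAt_id p).sub_const p)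
    exact h1.fst.prodMk (hφp.differentiableAt one_ne_zero).hasFDerivAt.snd
  have hinj : Function.Injective θ' := by
    rw [injective_iff_map_eq_zero]
    intro v hv
    rw [hθ'app, Prod.mk_eq_zero, hΛ1, ← hφE] at hv
    have h1 : v ∈ E p ⊓ Y := ⟨hv.2, hv.1⟩
    rwa [hpE.inf_eq_bot, Submodule.mem_bot] at h1
  let e : Euc (m + n) ≃L[ℝ] Euc m × Euc n :=
    (LinearEquiv.ofInjectiveOfFinrankEq θ'.toLinearMap hinj
      (by simp)).toContinuousLinearEquiv
  have he : (e : Euc (m + n) →L[ℝ] Euc m × Euc n) = θ' := by ext1 v; rfl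
  have hθe : HasFDerivAt θ (e : Euc (m + n) →L[ℝ] Euc m × Euc n) p := he ▸ hθ'
  have hstrict : HasStrictFDerivAt θ (e : Euc (m + n) →L[ℝ] Euc m × Euc n) p :=
    hθ.hasStrictFDerivAt' hθe one_ne_zero
  have hθp : θ p = 0 := by
    have : (φ p).2 = 0 := (hφN p hsrc).1 hp
    simp [θ, this]
  obtain ⟨g, hg, hgl, hgr⟩ : ∃ g : Euc m × Euc n → Euc (m + n), ContDiffAt ℝ 1 g 0 ∧
      (∀ᶠ q in 𝓝 p, g (θ q) = q) ∧ ∀ᶠ z in 𝓝 0, θ (g z) = z := by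
    refine ⟨hθ.localInverse hθe one_ne_zero, ?_, hstrict.eventually_left_inverse, ?_⟩
    · rw [← hθp]; exact hθ.to_localInverse hθe one_ne_zero
    · rw [← hθp]; exact hstrict.eventually_right_inverse
  have hg0 : g 0 = p := by rw [← hθp]; exact hgl.self_of_nhds
  let j : Euc (m + n) →L[ℝ] Euc m × Euc n :=
    (ContinuousLinearMap.fst ℝ (Euc m) (Euc n) ∘L (Λ : Euc (m + n) →L[ℝ] Euc m × Euc n)).prod 0
  have hjapp : ∀ v, j v = ((Λ v).1, 0) := fun v => rfl
  have hgood : ∀ᶠ x in 𝓝 (0 : Euc (m + n)), θ (g (j x)) = j x ∧ DifferentiableAt ℝ g (j x) ∧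
      g (j x) ∈ φ.source ∧ g (j x) ∈ Metric.closedBall p R := by
    have h1 : ∀ᶠ z in 𝓝 (0 : Euc m × Euc n), θ (g z) = z ∧ DifferentiableAt ℝ g z ∧
        g z ∈ φ.source ∧ g z ∈ Metric.closedBall p R := by
      have h2 : ∀ᶠ z in 𝓝 (0 : Euc m × Euc n), ContDiffAt ℝ 1 g z :=
        hg.eventually (by simp)
      have h3 := hg.continuousAt.eventually (hg0.symm ▸ φ.open_source.mem_nhds hsrc)
      have h4 : ∀ᶠ z in 𝓝 (0 : Euc m × Euc n), g z ∈ Metric.closedBall p R :=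
        hg.continuousAt.eventually (by rw [hg0]; exact Metric.closedBall_mem_nhds p hR)
      filter_upwards [hgr, h2, h3, h4] with z hz1 hz2 hz3 hz4
      exact ⟨hz1, hz2.differentiableAt one_ne_zero, hz3, hz4⟩
    exact j.continuous.continuousAt.eventually ((map_zero j).symm ▸ h1)
  obtain ⟨τ, hτ, hτg⟩ := Metric.eventually_nhds_iff.1 hgood
  have hτN : ∀ x, ‖x‖ < τ → g (j x) ∈ N := by
    intro x hx
    obtain ⟨h1, -, h2, -⟩ := hτg (by simpa using hx)
    rw [hφN _ h2]
    exact congrArg Prod.snd h1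
  refine ⟨fun ξ t => g (j (t • ξ)), ?_, ?_⟩
  · filter_upwards [Metric.ball_mem_nhds (0 : Euc (m + n)) hτ] with ξ hξ
    rw [mem_ball_zero_iff] at hξ
    refine ⟨by simp [hg0], fun t ht => ?_⟩
    have htξ : ‖t • ξ‖ < τ := by
      rw [norm_smul, Real.norm_of_nonneg ht.1]
      exact (mul_le_of_le_one_left (norm_nonneg _) ht.2).trans_lt hξ
    have hev : ∀ᶠ s : ℝ in 𝓝 t, ‖s • ξ‖ < τ :=
      ((continuous_id.smul continuous_const).norm.continuousAt (x := t)).eventually_lt_const htξ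
    obtain ⟨-, hdg, -, hball⟩ := hτg (y := t • ξ) (by simpa using htξ)
    refine ⟨⟨hτN _ htξ, hball⟩, ?_⟩
    have hγ : HasDerivAt (fun s : ℝ => g (j (s • ξ)))
        (fderiv ℝ g (j (t • ξ)) (j ((1 : ℝ) • ξ))) t :=
      hdg.hasFDerivAt.comp_hasDerivAt t
        (j.hasFDerivAt.comp_hasDerivAt t ((hasDerivAt_id t).smul_const ξ))
    set v := fderiv ℝ g (j (t • ξ)) (j ((1 : ℝ) • ξ))
    have hvE : v ∈ E (g (j (t • ξ))) :=
      hN.mem_of_hasDerivAt hγ (hev.mono fun s hs => hτN _ hs)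
    have hvY : v - ξ ∈ Y := by
      rw [← hΛ1, map_sub, Prod.fst_sub, sub_eq_zero]
      have h1 : HasDerivAt (fun s : ℝ => (Λ (g (j (s • ξ)) - p)).1) (Λ v).1 t :=
        (ContinuousLinearMap.fst ℝ (Euc m) (Euc n)).hasFDerivAt.comp_hasDerivAt t
          (Λ.hasFDerivAt.comp_hasDerivAt t (hγ.sub_const p))
      have h2 : HasDerivAt (fun s : ℝ => (Λ (s • ξ)).1) (Λ ((1 : ℝ) • ξ)).1 t :=
        (ContinuousLinearMap.fst ℝ (Euc m) (Euc n)).hasFDerivAt.comp_hasDerivAt t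
          (Λ.hasFDerivAt.comp_hasDerivAt t ((hasDerivAt_id t).smul_const ξ))
      have h3 : (fun s : ℝ => (Λ (g (j (s • ξ)) - p)).1) =ᶠ[𝓝 t] fun s => (Λ (s • ξ)).1 := by
        filter_upwards [hev] with s hs
        have h4 := congrArg Prod.fst (hτg (y := s • ξ) (by simpa using hs)).1
        exact h4
      rw [one_smul] at h2
      exact h1.unique (h2.congr_of_eventuallyEq h3)
    have hvp : projAlong Y (E (g (j (t • ξ)))) ξ = v :=
      projAlong_eq_of_mem (hE _ (hN.1 (hτN _ htξ))) hvE hvY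
    change HasDerivWithinAt _ (projAlong Y (E (g (j (t • ξ)))) ξ) _ _
    rw [hvp]
    exact hγ.hasDerivWithinAt
  · filter_upwards [hgl, φ.open_source.mem_nhds hsrc] with q hq hqs hqN
    have h1 : j ((1 : ℝ) • (q - p)) = θ q := by
      rw [one_smul, hjapp]
      simp only [θ, (hφN q hqs).1 hqN]
    simp only [h1, hq]

/-- For an exterior regular bundle, lifts of short segments are determined by the initial point,
although the bundle is merely continuous. -/
theorem ExteriorRegular.exists_unique_lifts (hU : IsOpen U) (hE : IsSubbundle 0 m U E)
    (h : ExteriorRegular m n U E) {p₀ : Euc (m + n)} (hp₀ : p₀ ∈ U) :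
    ∃ Y, (∀ p ∈ U, IsCompl (E p) Y) ∧ ∃ R > 0, ∃ ρ > 0, ∀ ξ, ‖ξ‖ ≤ ρ → ∀ γ₁ γ₂,
      IsLift Y E (Metric.closedBall p₀ R) ξ 1 γ₁ → IsLift Y E (Metric.closedBall p₀ R) ξ 1 γ₂ →
      γ₁ 0 = γ₂ 0 → γ₁ 1 = γ₂ 1 := by
  obtain ⟨Y, hY, Ek, ⟨-, hk, hconv⟩, ε, hε, s, O, B, hc, hlim⟩ := h
  have hcont := hE.continuousOn_projAlong hY
  obtain ⟨r, hr, C, hC0, hrU, hC, hCk, -⟩ :=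
    exists_ball_uniform_convergence hU hE hY hk hconv hp₀
  set ρ := min (r / 2) ε / C with hρdef
  have hρ : 0 < ρ := by positivity
  have hCρ : C * ρ = min (r / 2) ε := by rw [hρdef]; field_simp
  refine ⟨Y, hY, r / 2, by positivity, ρ, hρ, fun ξ hξ γ₁ γ₂ h₁ h₂ h0 => ?_⟩
  refine eq_of_dist_eq_zero (le_antisymm (le_of_forall_pos_le_add fun c hc' => ?_) dist_nonneg)
  set δ := c / 2 / (C * ρ + 1) with hδdef
  have hδ : 0 < δ := by positivity
  have hev := hlim.eventually (gt_mem_nhds (ENNReal.ofReal_pos.2 hδ))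
  obtain ⟨k, hX, hCk'⟩ := (hev.and hCk).exists
  obtain ⟨L, hL⟩ := (((hc k).contDiffOn_projAlong (hk k)).mono hrU).exists_lipschitzOnWith
    one_ne_zero (convex_closedBall p₀ r) (isCompact_closedBall p₀ r)
  have hΦ : ∀ p : Euc (m + n), ∃ u : ℝ → Euc (m + n), p ∈ Metric.closedBall p₀ (r / 2) →
      u 0 = p ∧ IsLift Y (Ek k) (Metric.closedBall p₀ r) ξ 1 u := by
    intro p
    by_cases hp : p ∈ Metric.closedBall p₀ (r / 2)
    · obtain ⟨u, hu⟩ := exists_isLift hL hCk' hC0.le hr.le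
        (hCρ.le.trans (min_le_left _ _)) hp hξ
      exact ⟨u, fun _ => hu⟩
    · exact ⟨fun _ => 0, fun h => absurd h hp⟩
  choose Φ hΦ using hΦ
  have key : ∀ γ, IsLift Y E (Metric.closedBall p₀ (r / 2)) ξ 1 γ →
      ‖γ 1 - Φ (γ 0) 1‖ ≤ δ * (C * ρ + 1) := fun γ hγ =>
    norm_sub_le_of_supRestrict (hc k) hY (hk k) hr hrU hC0.le hC hCk' hcont hξ hε
      (hCρ.le.trans (min_le_right _ _)) hδ hX.le hΦ hγ
  have h3 := key γ₁ h₁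
  have h4 := key γ₂ h₂
  rw [← h0, norm_sub_rev] at h4
  have h5 : δ * (C * ρ + 1) = c / 2 := by rw [hδdef]; field_simp
  rw [dist_eq_norm]
  linarith [norm_sub_le_norm_sub_add_norm_sub (γ₁ 1) (Φ (γ₁ 0) 1) (γ₂ 1)]

/-- The point `q` of `N₁` is the endpoint of the lift in `N₁` of the segment from `p` to `q`; by
uniqueness, the lift in `N₂` ends there too. -/
theorem ExteriorRegular.eventually_mem (hU : IsOpen U) (hE : IsSubbundle 0 m U E)
    (h : ExteriorRegular m n U E) {N₁ N₂ : Set (Euc (m + n))}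
    (h₁ : IsIntegralManifold m n U E N₁) (h₂ : IsIntegralManifold m n U E N₂)
    {p : Euc (m + n)} (hp₁ : p ∈ N₁) (hp₂ : p ∈ N₂) : ∀ᶠ q in 𝓝 p, q ∈ N₁ → q ∈ N₂ := by
  have hpU := h₁.1 hp₁
  obtain ⟨Y, hY, R, hR, ρ, hρ, huniq⟩ := h.exists_unique_lifts hU hE hpU
  have hm := hE.finrank_eq hpU
  obtain ⟨Γ₁, hΓ₁, hend⟩ := h₁.exists_lifts hY hp₁ hm hR
  obtain ⟨Γ₂, hΓ₂, -⟩ := h₂.exists_lifts hY hp₂ hm hR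
  have hsub : Tendsto (fun q => q - p) (𝓝 p) (𝓝 0) := by
    have : Tendsto (fun q => q - p) (𝓝 p) (𝓝 (p - p)) := tendsto_id.sub_const p
    rwa [sub_self] at this
  filter_upwards [hend, hsub.eventually hΓ₁, hsub.eventually hΓ₂,
    hsub.eventually (Metric.closedBall_mem_nhds 0 hρ)] with q hq hq₁ hq₂ hqρ hqN
  have hmono : ∀ {N : Set (Euc (m + n))} {ξ u},
      IsLift Y E (N ∩ Metric.closedBall p R) ξ 1 u → IsLift Y E (Metric.closedBall p R) ξ 1 u :=
    fun hu t ht => ⟨(hu t ht).1.2, (hu t ht).2⟩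
  have heq := huniq (q - p) (by simpa using hqρ) _ _ (hmono hq₁.2) (hmono hq₂.2)
    (hq₁.1.trans hq₂.1.symm)
  rw [← hq hqN, heq]
  exact (hq₂.2 1 (by simp)).1.1

/-- Two integral manifolds of an exterior regular bundle meet in a relatively open set. -/
theorem ExteriorRegular.isOpen_preimage (hU : IsOpen U) (hE : IsSubbundle 0 m U E)
    (h : ExteriorRegular m n U E) {N₁ N₂ : Set (Euc (m + n))}
    (h₁ : IsIntegralManifold m n U E N₁) (h₂ : IsIntegralManifold m n U E N₂) :
    IsOpen ((↑) ⁻¹' N₂ : Set N₁) := by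
  rw [isOpen_iff_mem_nhds]
  intro x hx
  filter_upwards [continuous_subtype_val.continuousAt.eventually
    (h.eventually_mem hU hE h₁ h₂ x.2 hx)] with y hy
  exact hy y.2

end Intersection

end AsymptoticFrobenius

theorem mainTheorem1 (m n : ℕ) (U : Set (AsymptoticFrobenius.Euc (m + n))) (hU : IsOpen U)
    (E : AsymptoticFrobenius.Euc (m + n) → Submodule ℝ (AsymptoticFrobenius.Euc (m + n)))
    (hE : AsymptoticFrobenius.IsSubbundle 0 m U E) :
    (AsymptoticFrobenius.AsymptoticallyInvolutive m n U E →
      AsymptoticFrobenius.Integrable m n U E) ∧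
    (AsymptoticFrobenius.Integrable m n U E → AsymptoticFrobenius.ExteriorRegular m n U E →
      AsymptoticFrobenius.UniquelyIntegrable m n U E) :=
  ⟨fun h => h.integrable hU hE, fun hI h => ⟨hI, fun _ _ h₁ h₂ =>
    ⟨h.isOpen_preimage hU hE h₁ h₂, h.isOpen_preimage hU hE h₂ h₁⟩⟩⟩
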